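/- Let $M$ be a manifold (any topological space will do), let $K(M)$ be the Grothendieck ring of complex vector bundles on $M$, and let $K_{Tate}(M)=K(M)[[q]]$. A vector bundle $V$ on $M$ is viewed as the constant power series $Vq^0$. For a topological groupoid $X$ let $\Lambda X$ be its inertia groupoid, $S(X)=\coprod_{n\ge 0}S_n\!\int\! X$ its total symmetric power, and $\Phi(X)=\coprod_{k\ge 1}\Phi_k(X)\subset\Lambda(S(X))$ the full subgroupoid of those objects $(x_1,\dots,x_k;g)$ for which the permutation underlying $g$ is the standard long cycle of length $k$. Let $Q\colon S(\Phi(M))\to\Lambda(S(M))$ be concatenation. Let $\theta(V)$ be the bundle on $\Phi(M)$ whose restriction to $\Phi_k(M)$ (objects: constant $k$-tuples) is the pull-back of $V$ along $(x,\dots,x)\mapsto x$, with the arrows acting by identity maps, and let $P(W)=(W^{\otimes n})_{n\ge 0}$ be the total Atiyah power operation. Then: 1. There is, up to isomorphism, exactly one vector bundle $P^{Tate}(V)=(Q^*)^{-1}P(\theta(V))$ on $\Lambda(S(M))$ on which the canonical centre element $\xi$ of $\Lambda(S(M))$ acts trivially and whose pull-back along $Q$ is isomorphic to $P(\theta(V))$.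 2. Let $S_t^{Tate}(V)=\epsilon_!\,\delta^*P^{Tate}(V)\in K_{Tate}(M)[[t]]$ be the total symmetric power of $V$ in Tate $K$-theory, and let $S_t(V)=\epsilon_!\,\delta^*P(V)\in K_{Tate}(M)[[t]]$ be the total Atiyah symmetric power, where $\delta\colon S(\mathrm{pt})\times M\to S(M)$ is the diagonal, $\epsilon\colon S(\mathrm{pt})\times M\to\mathbb N\times M$ is the augmentation and $\epsilon_!$ is the transfer (right Kan extension); in the Tate case $\delta$ and $\epsilon$ are replaced by the functors they induce on inertia groupoids. Then the infinite product below converges $t$-adically and $$S_t^{Tate}(V)\;=\;\bigotimes_{k\ge 1}S_{t^k}(V),$$ that is, $S_t^{Tate}(V)$ is Witten's stable exponential characteristic class of $V$. -/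

import Mathlib

open CategoryTheory
open scoped TensorProduct

noncomputable section

namespace TateK

universe u

/-! ## Complex vector bundles on a space -/

/-- A (finite dimensional, complex, topological) vector bundle on `B`, given by its fibres and an
atlas of local frames whose transition coefficients are continuous. The rank may vary from one
component of `B` to another. For a label `a` of a local frame, `U a` is the open set on which the
frame `s a` lives; the values of `s a i` outside of `U a` are irrelevant. -/
structure VB (B : Type u) [TopologicalSpace B] : Type (u + 1) where
  E : B → Type
  [acg : ∀ b, AddCommGroup (E b)]
  [mod : ∀ b, Module ℂ (E b)]
  A : Type u
  U : A → Set B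
  ι : A → Type
  [fin : ∀ a, Fintype (ι a)]
  s : ∀ a, ι a → ∀ b, E b
  isOpen : ∀ a, IsOpen (U a)
  cover : ∀ b, ∃ a, b ∈ U a
  indep : ∀ a, ∀ b ∈ U a, LinearIndependent ℂ (fun i => s a i b)
  spans : ∀ a, ∀ b ∈ U a, ⊤ ≤ Submodule.span ℂ (Set.range fun i => s a i b)
  compat : ∀ a a' i, ∃ c : ι a' → B → ℂ, (∀ j, ContinuousOn (c j) (U a ∩ U a')) ∧
    ∀ b ∈ U a ∩ U a', s a i b = ∑ j, c j b • s a' j b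

attribute [instance] VB.acg VB.mod VB.fin

/-- A family of linear maps between fibres, indexed by a space `T` over the base spaces `B` and
`B'`, is continuous if its matrix coefficients with respect to local frames are continuous. -/
def ContHom {B B' T : Type*} [TopologicalSpace B] [TopologicalSpace B'] [TopologicalSpace T]
    (E : VB B) (E' : VB B') (p : T → B) (p' : T → B')
    (f : ∀ t, E.E (p t) →ₗ[ℂ] E'.E (p' t)) : Prop :=
  ∀ a a' i, ∃ c : E'.ι a' → T → ℂ,
    (∀ j, ContinuousOn (c j) {t | p t ∈ E.U a ∧ p' t ∈ E'.U a'}) ∧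
    ∀ t, p t ∈ E.U a → p' t ∈ E'.U a' →
      f t (E.s a i (p t)) = ∑ j, c j t • E'.s a' j (p' t)

namespace VB

variable {B B' : Type u} [TopologicalSpace B] [TopologicalSpace B']

/-- Isomorphism of vector bundles on `B`. -/
def Iso (E F : VB B) : Prop :=
  ∃ f : ∀ b, E.E b ≃ₗ[ℂ] F.E b,
    ContHom E F id id (fun b => (f b).toLinearMap) ∧
    ContHom F E id id (fun b => (f b).symm.toLinearMap)

/-- The basis of the fibre at `b ∈ U a` given by the local frame. -/
def basis (E : VB B) (a : E.A) (b : B) (hb : b ∈ E.U a) : Module.Basis (E.ι a) ℂ (E.E b) :=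
  Module.Basis.mk (E.indep a b hb) (E.spans a b hb)

@[simp] lemma basis_apply (E : VB B) (a : E.A) (b : B) (hb : b ∈ E.U a) (i : E.ι a) :
    E.basis a b hb i = E.s a i b := by
  simp [basis]

lemma indep_of_basis {ι V : Type*} [AddCommGroup V] [Module ℂ V] (β : Module.Basis ι ℂ V)
    (v : ι → V) (h : ∀ i, β i = v i) : LinearIndependent ℂ v := by
  rw [← funext h]; exact β.linearIndependent

lemma spans_of_basis {ι V : Type*} [AddCommGroup V] [Module ℂ V] (β : Module.Basis ι ℂ V)
    (v : ι → V) (h : ∀ i, β i = v i) : ⊤ ≤ Submodule.span ℂ (Set.range v) := by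
  rw [← funext h]; exact β.span_eq.ge

/-- Pull-back of a vector bundle along a continuous map. -/
def pullback (E : VB B) (f : B' → B) (hf : Continuous f) : VB B' where
  E b := E.E (f b)
  A := ULift.{u} E.A
  U a := f ⁻¹' E.U a.down
  ι a := E.ι a.down
  s a i b := E.s a.down i (f b)
  isOpen a := (E.isOpen a.down).preimage hf
  cover b := (E.cover (f b)).imp' ULift.up fun _ h => h
  indep a b hb := E.indep a.down _ hb
  spans a b hb := E.spans a.down _ hb
  compat a a' i := by
    obtain ⟨c, hc, h⟩ := E.compat a.down a'.down i
    exact ⟨fun j b => c j (f b),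
      fun j => (hc j).comp hf.continuousOn fun b hb => hb, fun b hb => h _ hb⟩

variable (B) in
/-- The trivial line bundle. -/
def one : VB B where
  E _ := ℂ
  A := PUnit
  U _ := Set.univ
  ι _ := Unit
  s _ _ _ := 1
  isOpen _ := isOpen_univ
  cover _ := ⟨⟨⟩, trivial⟩
  indep _ _ _ := by simp
  spans _ b _ := by
    rw [Set.range_const, Ideal.submodule_span_eq, Ideal.span_singleton_one]
  compat _ _ _ := ⟨fun _ _ => 1, fun _ => continuousOn_const, by simp⟩

/-- The zero bundle. -/
instance : Inhabited (VB B) := ⟨{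
  E := fun _ => PUnit
  A := PUnit
  U := fun _ => Set.univ
  ι := fun _ => Empty
  s := fun _ i => i.elim
  isOpen := fun _ => isOpen_univ
  cover := fun _ => ⟨⟨⟩, trivial⟩
  indep := fun _ _ _ => linearIndependent_empty_type
  spans := fun _ b _ x _ => by
    have : x = 0 := rfl
    rw [this]; exact Submodule.zero_mem _
  compat := fun _ _ i => i.elim }⟩

/-- Direct sum of vector bundles. -/
def sum (E F : VB B) : VB B where
  E b := E.E b × F.E b
  A := E.A × F.A
  U a := E.U a.1 ∩ F.U a.2
  ι a := E.ι a.1 ⊕ F.ι a.2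
  s a i b := Sum.elim (fun i => (E.s a.1 i b, 0)) (fun i => (0, F.s a.2 i b)) i
  isOpen a := (E.isOpen a.1).inter (F.isOpen a.2)
  cover b := by
    obtain ⟨a, ha⟩ := E.cover b
    obtain ⟨a', ha'⟩ := F.cover b
    exact ⟨(a, a'), ha, ha'⟩
  indep a b hb := indep_of_basis
    ((E.basis a.1 b hb.1).prod (F.basis a.2 b hb.2)) _ fun i => by cases i <;> simp
  spans a b hb := spans_of_basis
    ((E.basis a.1 b hb.1).prod (F.basis a.2 b hb.2)) _ fun i => by cases i <;> simp
  compat a a' i := by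
    rcases i with i | i
    · obtain ⟨c, hc, h⟩ := E.compat a.1 a'.1 i
      refine ⟨Sum.elim c fun _ _ => 0, ?_, fun b hb => ?_⟩
      · rintro (j | j)
        · exact (hc j).mono fun b hb => ⟨hb.1.1, hb.2.1⟩
        · exact continuousOn_const
      · simp [h b ⟨hb.1.1, hb.2.1⟩, Prod.ext_iff, Prod.fst_sum, Prod.snd_sum]
    · obtain ⟨c, hc, h⟩ := F.compat a.2 a'.2 i
      refine ⟨Sum.elim (fun _ _ => 0) c, ?_, fun b hb => ?_⟩
      · rintro (j | j)
        · exact continuousOn_const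
        · exact (hc j).mono fun b hb => ⟨hb.1.2, hb.2.2⟩
      · simp [h b ⟨hb.1.2, hb.2.2⟩, Prod.ext_iff, Prod.fst_sum, Prod.snd_sum]

/-- Tensor product of vector bundles. -/
def tensor (E F : VB B) : VB B where
  E b := E.E b ⊗[ℂ] F.E b
  A := E.A × F.A
  U a := E.U a.1 ∩ F.U a.2
  ι a := E.ι a.1 × F.ι a.2
  s a i b := E.s a.1 i.1 b ⊗ₜ[ℂ] F.s a.2 i.2 b
  isOpen a := (E.isOpen a.1).inter (F.isOpen a.2)
  cover b := by
    obtain ⟨a, ha⟩ := E.cover b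
    obtain ⟨a', ha'⟩ := F.cover b
    exact ⟨(a, a'), ha, ha'⟩
  indep a b hb := indep_of_basis
    ((E.basis a.1 b hb.1).tensorProduct (F.basis a.2 b hb.2)) _ fun i => by simp [Module.Basis.tensorProduct_apply']
  spans a b hb := spans_of_basis
    ((E.basis a.1 b hb.1).tensorProduct (F.basis a.2 b hb.2)) _ fun i => by simp [Module.Basis.tensorProduct_apply']
  compat a a' i := by
    obtain ⟨c, hc, h⟩ := E.compat a.1 a'.1 i.1
    obtain ⟨d, hd, h'⟩ := F.compat a.2 a'.2 i.2
    refine ⟨fun j b => c j.1 b * d j.2 b, fun j => ?_, fun b hb => ?_⟩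
    · exact ((hc j.1).mono fun b hb => ⟨hb.1.1, hb.2.1⟩).mul
        ((hd j.2).mono fun b hb => ⟨hb.1.2, hb.2.2⟩)
    · rw [h b ⟨hb.1.1, hb.2.1⟩, h' b ⟨hb.1.2, hb.2.2⟩, TensorProduct.sum_tmul,
        Fintype.sum_prod_type]
      simp_rw [TensorProduct.tmul_sum, TensorProduct.smul_tmul_smul]

/-- External tensor product of finitely many vector bundles. -/
def extTensor {n : ℕ} {Y : Fin n → Type u} [∀ i, TopologicalSpace (Y i)]
    (E : ∀ i, VB (Y i)) : VB (∀ i, Y i) where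
  E b := PiTensorProduct ℂ fun i => (E i).E (b i)
  A := ∀ i, (E i).A
  U a := {b | ∀ i, b i ∈ (E i).U (a i)}
  ι a := ∀ i, (E i).ι (a i)
  s a k b := PiTensorProduct.tprod ℂ fun i => (E i).s (a i) (k i) (b i)
  isOpen a := by
    have : {b : ∀ i, Y i | ∀ i, b i ∈ (E i).U (a i)} = Set.pi Set.univ fun i => (E i).U (a i) := by
      ext; simp
    rw [this]
    exact isOpen_set_pi Set.finite_univ fun i _ => (E i).isOpen (a i)
  cover b := by
    choose a ha using fun i => (E i).cover (b i)
    exact ⟨a, ha⟩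
  indep a b hb := indep_of_basis
    (Basis.piTensorProduct fun i => (E i).basis (a i) (b i) (hb i)) _ fun k => by simp
  spans a b hb := spans_of_basis
    (Basis.piTensorProduct fun i => (E i).basis (a i) (b i) (hb i)) _ fun k => by simp
  compat a a' k := by
    choose c hc h using fun i => (E i).compat (a i) (a' i) (k i)
    refine ⟨fun l b => ∏ i, c i (l i) (b i), fun l => ?_, fun b hb => ?_⟩
    · refine continuousOn_finsetProd _ fun i _ => ?_
      exact (hc i (l i)).comp (continuous_apply i).continuousOn fun b hb => ⟨hb.1 i, hb.2 i⟩
    · have : (fun i => (E i).s (a i) (k i) (b i)) =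
          fun i => ∑ j, c i j (b i) • (E i).s (a' i) j (b i) :=
        funext fun i => h i (b i) ⟨hb.1 i, hb.2 i⟩
      rw [this, MultilinearMap.map_sum]
      simp_rw [MultilinearMap.map_smul_univ]

end VB

/-! ## The ring `K(M)` -/

/-- The relations of the Grothendieck ring of complex vector bundles. -/
inductive KRel (M : Type u) [TopologicalSpace M] : FreeCommRing (VB M) → Prop
  | iso (E F : VB M) : E.Iso F → KRel M (.of E - .of F)
  | sum (E F : VB M) : KRel M (.of (E.sum F) - (.of E + .of F))
  | tensor (E F : VB M) : KRel M (.of (E.tensor F) - .of E * .of F)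
  | one : KRel M (.of (VB.one M) - 1)

/-- The Grothendieck ring of complex vector bundles on `M`: the ring generated by the isomorphism
classes `[E]` subject to `[E ⊕ F] = [E] + [F]`, `[E ⊗ F] = [E][F]` and `[ℂ] = 1`. -/
abbrev K (M : Type u) [TopologicalSpace M] : Type (u + 1) :=
  FreeCommRing (VB M) ⧸ Ideal.span {x | KRel M x}

/-- The class of a vector bundle in `K(M)`. -/
def VB.cls {M : Type u} [TopologicalSpace M] (E : VB M) : K M :=
  Ideal.Quotient.mk _ (.of E)

/-- The Tate `K`-theory `K_Tate(M) = K(M)⟦q⟧` of a space. -/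
abbrev KTate (M : Type u) [TopologicalSpace M] : Type (u + 1) := PowerSeries (K M)

/-! ## Topological groupoids

All topological groupoids below are translation groupoids: a discrete groupoid `Ix` acts on a
family of spaces `fib c`, `c : Ix`. The space of objects is the topological sum of the `fib c`, and
the arrows from `b : fib c` to `b' : fib d` are the `γ : c ⟶ d` with `tr γ b = b'`. A one-object
`Ix` gives the translation groupoid `M // G`. -/

structure TGpd : Type (u + 1) where
  Ix : Type
  [gpd : Groupoid.{0} Ix]
  fib : Ix → Type u
  [top : ∀ c, TopologicalSpace (fib c)]
  tr : ∀ {c d : Ix}, (c ⟶ d) → fib c → fib d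
  tr_cont : ∀ {c d : Ix} (γ : c ⟶ d), Continuous (tr γ)
  tr_id : ∀ (c : Ix) (b : fib c), tr (𝟙 c) b = b
  tr_comp : ∀ {c d e : Ix} (γ : c ⟶ d) (δ : d ⟶ e) (b : fib c), tr (γ ≫ δ) b = tr δ (tr γ b)

attribute [instance] TGpd.gpd TGpd.top

/-- The space of all arrows that belong to `γ`. -/
def TGpd.Arr (X : TGpd.{u}) {c d : X.Ix} (γ : c ⟶ d) : Type u :=
  {q : X.fib c × X.fib d // X.tr γ q.1 = q.2}

instance (X : TGpd.{u}) {c d : X.Ix} (γ : c ⟶ d) : TopologicalSpace (X.Arr γ) :=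
  inferInstanceAs (TopologicalSpace {q : X.fib c × X.fib d // X.tr γ q.1 = q.2})

/-- A continuous functor between topological groupoids. -/
structure TFun (X Y : TGpd.{u}) where
  ix : X.Ix ⥤ Y.Ix
  map : ∀ c, X.fib c → Y.fib (ix.obj c)
  map_cont : ∀ c, Continuous (map c)
  map_tr : ∀ {c d : X.Ix} (γ : c ⟶ d) (b : X.fib c),
    Y.tr (ix.map γ) (map c b) = map d (X.tr γ b)

/-- A vector bundle on a topological groupoid: a vector bundle on the space of objects with a
continuous action of the arrows. -/
structure GVB (X : TGpd.{u}) : Type (u + 1) where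
  bdl : ∀ c, VB (X.fib c)
  act : ∀ {c d : X.Ix} (γ : c ⟶ d) {b : X.fib c} {b' : X.fib d}, X.tr γ b = b' →
    ((bdl c).E b →ₗ[ℂ] (bdl d).E b')
  act_cont : ∀ {c d : X.Ix} (γ : c ⟶ d), ContHom (T := X.Arr γ) (bdl c) (bdl d)
    (fun q => q.1.1) (fun q => q.1.2) (fun q => act γ q.2)
  act_id : ∀ {c : X.Ix} {b : X.fib c} (h : X.tr (𝟙 c) b = b) (v : (bdl c).E b), act (𝟙 c) h v = v
  act_comp : ∀ {c d e : X.Ix} (γ : c ⟶ d) (δ : d ⟶ e) {b : X.fib c} {b' : X.fib d}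
    {b'' : X.fib e} (h : X.tr γ b = b') (h' : X.tr δ b' = b'') (h'' : X.tr (γ ≫ δ) b = b'')
    (v : (bdl c).E b), act (γ ≫ δ) h'' v = act δ h' (act γ h v)

namespace GVB

variable {X Y : TGpd.{u}}

/-- Isomorphism of vector bundles on a topological groupoid. -/
def Iso (V W : GVB X) : Prop :=
  ∃ f : ∀ c b, (V.bdl c).E b ≃ₗ[ℂ] (W.bdl c).E b,
    (∀ c, ContHom (V.bdl c) (W.bdl c) id id (fun b => (f c b).toLinearMap)) ∧
    (∀ c, ContHom (W.bdl c) (V.bdl c) id id (fun b => (f c b).symm.toLinearMap)) ∧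
    ∀ {c d : X.Ix} (γ : c ⟶ d) {b : X.fib c} {b' : X.fib d} (h : X.tr γ b = b')
      (v : (V.bdl c).E b), f d b' (V.act γ h v) = W.act γ h (f c b v)

/-- The zero bundle. -/
instance : Inhabited (GVB X) := ⟨{
  bdl := fun _ => default
  act := fun _ _ _ _ => 0
  act_cont := fun _ _ _ i => i.elim
  act_id := fun _ _ => rfl
  act_comp := fun _ _ _ _ _ _ _ _ _ => rfl }⟩

/-- Pull-back along a continuous functor. -/
def pullback (F : TFun X Y) (V : GVB Y) : GVB X where
  bdl c := (V.bdl (F.ix.obj c)).pullback (F.map c) (F.map_cont c)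
  act {c d} γ {b b'} h := V.act (F.ix.map γ) (b := F.map c b) (b' := F.map d b')
    (by rw [F.map_tr, h])
  act_cont {c d} γ a a' i := by
    obtain ⟨k, hk, h⟩ := V.act_cont (F.ix.map γ) a.down a'.down i
    have hφ : Continuous fun q : X.Arr γ =>
        (⟨(F.map c q.1.1, F.map d q.1.2), by rw [F.map_tr, q.2]⟩ : Y.Arr (F.ix.map γ)) := by
      refine Continuous.subtype_mk ?_ _
      exact ((F.map_cont c).comp (continuous_fst.comp continuous_subtype_val)).prodMk
        ((F.map_cont d).comp (continuous_snd.comp continuous_subtype_val))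
    exact ⟨fun j q => k j _, fun j => (hk j).comp hφ.continuousOn fun q hq => hq,
      fun q hq hq' => h ⟨(F.map c q.1.1, F.map d q.1.2), by rw [F.map_tr, q.2]⟩ hq hq'⟩
  act_id {c b} h v := by
    have key : ∀ (δ : F.ix.obj c ⟶ F.ix.obj c) (e : δ = 𝟙 _)
        (h' : Y.tr δ (F.map c b) = F.map c b), V.act δ h' v = v := by
      rintro _ rfl h'; exact V.act_id h' v
    exact key _ (F.ix.map_id c) _
  act_comp {c d e} γ δ b b' b'' h h' h'' v := by
    have key : ∀ (ε : F.ix.obj c ⟶ F.ix.obj e) (_ : ε = F.ix.map γ ≫ F.ix.map δ)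
        (k : Y.tr ε (F.map c b) = F.map e b'')
        (k' : Y.tr (F.ix.map γ) (F.map c b) = F.map d b')
        (k'' : Y.tr (F.ix.map δ) (F.map d b') = F.map e b''),
        V.act ε k v = V.act (F.ix.map δ) k'' (V.act (F.ix.map γ) k' v) := by
      rintro _ rfl k k' k''; exact V.act_comp _ _ k' k'' k v
    exact key _ (F.ix.map_comp γ δ) _ _ _

end GVB

/-! ### Spaces, symmetric powers, inertia groupoids -/

/-- The product of a discrete groupoid with a space. -/
abbrev times (C : Type) [Groupoid.{0} C] (M : Type u) [TopologicalSpace M] : TGpd.{u} where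
  Ix := C
  fib _ := M
  tr _ b := b
  tr_cont _ := continuous_id
  tr_id _ _ := rfl
  tr_comp _ _ _ := rfl

/-- The one-arrow groupoid. -/
structure Pt : Type

instance : Groupoid.{0} Pt where
  Hom _ _ := Unit
  id _ := ()
  comp _ _ := ()
  inv _ := ()

/-- A space, viewed as a groupoid with identity arrows only. -/
abbrev space (M : Type u) [TopologicalSpace M] : TGpd.{u} := times Pt M

/-- Objects of the total symmetric power `S(C) = ∐ₙ Sₙ ∫ C`: finite lists of objects of `C`. -/
structure SymIx (C : Type) : Type where
  n : ℕ
  c : Fin n → C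

/-- An arrow `x ⟶ y` in `S(C)` is a permutation together with arrows in `C`. Here `perm` is the
inverse of the permutation `σ` that moves the entries: the `i`th entry of `x` is moved to
the position `j = σ i` of `y`, `i = perm j`, by `hom j`. -/
structure SymHom {C : Type} [Groupoid.{0} C] (x y : SymIx C) : Type where
  perm : Fin y.n ≃ Fin x.n
  hom : ∀ j, x.c (perm j) ⟶ y.c j

lemma SymHom.ext' {C : Type} [Groupoid.{0} C] {x y : SymIx C} {f g : SymHom x y}
    (h : ∀ j, f.perm j = g.perm j)
    (h' : ∀ j, f.hom j = eqToHom (by rw [h]) ≫ g.hom j) : f = g := by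
  obtain ⟨p, u⟩ := f
  obtain ⟨q, v⟩ := g
  obtain rfl : p = q := Equiv.ext h
  obtain rfl : u = v := funext fun j => by simpa using h' j
  rfl

instance symCategory (C : Type) [Groupoid.{0} C] : Category.{0} (SymIx C) where
  Hom x y := SymHom x y
  id x := ⟨Equiv.refl _, fun j => 𝟙 (x.c j)⟩
  comp f g := ⟨g.perm.trans f.perm, fun j => f.hom (g.perm j) ≫ g.hom j⟩
  id_comp := fun ⟨p, u⟩ => by
    change SymHom.mk p (fun j => 𝟙 _ ≫ u j) = _
    simp only [Category.id_comp]
  comp_id := fun ⟨p, u⟩ => by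
    change SymHom.mk p (fun j => u j ≫ 𝟙 _) = _
    simp only [Category.comp_id]
  assoc {w x y z} := fun ⟨p, u⟩ ⟨q, v⟩ ⟨r, t⟩ => by
    exact congrArg (SymHom.mk (x := w) (y := z) (r.trans (q.trans p)))
      (funext fun j => Category.assoc (u (q (r j))) (v (r j)) (t j))

lemma SymHom.hom_congr {C : Type} [Groupoid.{0} C] {x y : SymIx C} (f : SymHom x y)
    {j j' : Fin y.n} (h : j = j') :
    f.hom j = eqToHom (by rw [h]) ≫ f.hom j' ≫ eqToHom (by rw [h]) := by
  subst h; simp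

instance symGroupoid (C : Type) [Groupoid.{0} C] : Groupoid.{0} (SymIx C) where
  inv {x y} f := ⟨f.perm.symm, fun i =>
    Groupoid.inv (f.hom (f.perm.symm i)) ≫ eqToHom (by rw [Equiv.apply_symm_apply])⟩
  inv_comp {x y} f := by
    refine SymHom.ext' (fun j => f.perm.symm_apply_apply j) fun j => ?_
    have key : ∀ {a a' b b' : C} (u : a ⟶ b) (u' : a' ⟶ b') (p : a' = a) (q : b = b')
        (_ : u' = eqToHom p ≫ u ≫ eqToHom q) (t : a' = a),
        (Groupoid.inv u' ≫ eqToHom t) ≫ u = eqToHom q.symm ≫ 𝟙 b := by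
      rintro a _ b _ u _ rfl rfl rfl _; simp
    exact key _ _ _ _ (f.hom_congr (f.perm.symm_apply_apply j)) _
  comp_inv {x y} f := by
    refine SymHom.ext' (fun j => f.perm.apply_symm_apply j) fun j => ?_
    have key : ∀ {a b c : C} (u : a ⟶ b) (p q : a = c),
        u ≫ (Groupoid.inv u ≫ eqToHom p) = eqToHom q ≫ 𝟙 c := by
      rintro a b _ u rfl _; simp
    exact key _ _ _

/-- The total symmetric power `S(X)` of a topological groupoid. -/
abbrev Sym (X : TGpd.{u}) : TGpd.{u} where
  Ix := SymIx X.Ix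
  gpd := symGroupoid X.Ix
  fib x := ∀ i, X.fib (x.c i)
  tr {x y} (f : SymHom x y) b := fun j => X.tr (f.hom j) (b (f.perm j))
  tr_cont _ := continuous_pi fun _ => (X.tr_cont _).comp (continuous_apply _)
  tr_id _ _ := funext fun _ => X.tr_id _ _
  tr_comp _ _ _ := funext fun _ => X.tr_comp _ _ _

/-- Objects of the inertia groupoid: an object together with an automorphism. -/
structure InIx (C : Type) [Groupoid.{0} C] : Type where
  x : C
  g : x ⟶ x

instance inCategory (C : Type) [Groupoid.{0} C] : Category.{0} (InIx C) where
  Hom z w := {f : z.x ⟶ w.x // z.g ≫ f = f ≫ w.g}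
  id z := ⟨𝟙 _, by simp⟩
  comp f g := ⟨f.1 ≫ g.1, by rw [← Category.assoc, f.2, Category.assoc, g.2, Category.assoc]⟩
  id_comp f := Subtype.ext (Category.id_comp _)
  comp_id f := Subtype.ext (Category.comp_id _)
  assoc f g h := Subtype.ext (Category.assoc _ _ _)

instance inGroupoid (C : Type) [Groupoid.{0} C] : Groupoid.{0} (InIx C) where
  inv {z w} f := ⟨Groupoid.inv f.1, by
    have := congrArg (fun k => Groupoid.inv f.1 ≫ k ≫ Groupoid.inv f.1) f.2
    simpa using this.symm⟩
  inv_comp f := Subtype.ext (Groupoid.inv_comp _)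
  comp_inv f := Subtype.ext (Groupoid.comp_inv _)

/-- The inertia groupoid `Λ(X)` of a topological groupoid: its objects are the pairs of an object
`b` and an automorphism `g` of `b`. -/
abbrev Inertia (X : TGpd.{u}) : TGpd.{u} where
  Ix := InIx X.Ix
  gpd := inGroupoid X.Ix
  fib z := {b : X.fib z.x // X.tr z.g b = b}
  tr {z w} (f : {f : z.x ⟶ w.x // z.g ≫ f = f ≫ w.g}) b := ⟨X.tr f.1 b.1, by rw [← X.tr_comp, ← f.2, X.tr_comp, b.2]⟩
  tr_cont {z w} (f : {f : z.x ⟶ w.x // z.g ≫ f = f ≫ w.g}) := ((X.tr_cont f.1).comp continuous_subtype_val).subtype_mk _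
  tr_id z b := Subtype.ext (X.tr_id _ _)
  tr_comp f g b := Subtype.ext (X.tr_comp _ _ _)

/-- Objects of `Φ(C)`: objects `(x, g)` of the inertia groupoid of `S(C)` such that `x` has
`k ≥ 1` entries and the permutation of `g` is the standard long cycle of length `k`. -/
structure PhiIx (C : Type) [Groupoid.{0} C] : Type where
  z : InIx (SymIx C)
  pos : 0 < z.x.n
  rot : z.g.perm = (finRotate z.x.n).symm

instance phiCategory (C : Type) [Groupoid.{0} C] : Category.{0} (PhiIx C) where
  Hom p q := p.z ⟶ q.z
  id p := 𝟙 p.z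
  comp {p q r} f g := CategoryStruct.comp (X := p.z) (Y := q.z) (Z := r.z) f g
  id_comp {p q} f := Category.id_comp (X := p.z) (Y := q.z) f
  comp_id {p q} f := Category.comp_id (X := p.z) (Y := q.z) f
  assoc {p q r s} f g h := Category.assoc (W := p.z) (X := q.z) (Y := r.z) (Z := s.z) f g h

instance phiGroupoid (C : Type) [Groupoid.{0} C] : Groupoid.{0} (PhiIx C) where
  inv {p q} f := Groupoid.inv (X := p.z) (Y := q.z) f
  inv_comp {p q} f := Groupoid.inv_comp (X := p.z) (Y := q.z) f
  comp_inv {p q} f := Groupoid.comp_inv (X := p.z) (Y := q.z) f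

/-- The full subgroupoid `Φ(X) = ∐_{k ≥ 1} Φ_k(X)` of `Λ(S(X))`, see `PhiIx`. -/
abbrev Phi (X : TGpd.{u}) : TGpd.{u} where
  Ix := PhiIx X.Ix
  gpd := phiGroupoid X.Ix
  fib p := (Inertia (Sym X)).fib (show (Inertia (Sym X)).Ix from p.z)
  top p := (Inertia (Sym X)).top (show (Inertia (Sym X)).Ix from p.z)
  tr {p q} f := (Inertia (Sym X)).tr (c := show (Inertia (Sym X)).Ix from p.z)
    (d := show (Inertia (Sym X)).Ix from q.z) f
  tr_cont {p q} f := (Inertia (Sym X)).tr_cont (c := show (Inertia (Sym X)).Ix from p.z)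
    (d := show (Inertia (Sym X)).Ix from q.z) f
  tr_id p := (Inertia (Sym X)).tr_id (show (Inertia (Sym X)).Ix from p.z)
  tr_comp {p q r} f g := (Inertia (Sym X)).tr_comp (c := show (Inertia (Sym X)).Ix from p.z)
    (d := show (Inertia (Sym X)).Ix from q.z) (e := show (Inertia (Sym X)).Ix from r.z) f g

/-! ## Transfers

For a vector bundle `W` on `C × M`, with `C` a finite discrete groupoid, the transfer along the
projection to `M` is the right Kan extension, whose fibre at `x` is the limit of the functor
`c ↦ W_(c, x)`. More generally the limit is taken over the full subgroupoid of all `c : C` that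
satisfy a predicate `P`. -/

section Transfer

variable {C : Type} [Groupoid.{0} C] {M : Type u} [TopologicalSpace M]

/-- The limit over `{c // P c}` of the functor `c ↦ W_(c, x)`. -/
def limFibre (W : GVB (times C M)) (P : C → Prop) (x : M) :
    Submodule ℂ (∀ c : {c // P c}, (W.bdl c.1).E x) where
  carrier := {v | ∀ (c d : {c // P c}) (γ : c.1 ⟶ d.1), W.act γ (b := x) (b' := x) rfl (v c) = v d}
  zero_mem' _ _ _ := map_zero _
  add_mem' hv hw c d γ := by
    rw [Pi.add_apply, map_add, hv c d γ, hw c d γ]; rfl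
  smul_mem' r v hv c d γ := by
    rw [Pi.smul_apply, map_smul, hv c d γ]; rfl

/-- A local frame of the transfer: a family of bases of the fibres which consists of continuous
sections of `W`. -/
structure LimFrame (W : GVB (times C M)) (P : C → Prop) : Type u where
  U : Set M
  n : ℕ
  s : Fin n → ∀ x, limFibre W P x
  isOpen : IsOpen U
  indep : ∀ x ∈ U, LinearIndependent ℂ (fun i => s i x)
  spans : ∀ x ∈ U, ⊤ ≤ Submodule.span ℂ (Set.range fun i => s i x)
  cont : ∀ (i : Fin n) (c : {c // P c}) (a : (W.bdl c.1).A), ∃ k : (W.bdl c.1).ι a → M → ℂ,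
    (∀ j, ContinuousOn (k j) (U ∩ (W.bdl c.1).U a)) ∧
    ∀ x ∈ U ∩ (W.bdl c.1).U a, (s i x).1 c = ∑ j, k j x • (W.bdl c.1).s a j x

lemma continuousAt_coef {T κ : Type*} [TopologicalSpace T] [Finite κ] {n : ℕ} {x₀ : T}
    {S : T → κ → ℂ} {S' : Fin n → T → κ → ℂ} {c : Fin n → T → ℂ}
    (hS : ContinuousAt S x₀) (hS' : ∀ j, ContinuousAt (S' j) x₀)
    (h : ∀ᶠ x in nhds x₀, S x = ∑ j, c j x • S' j x)
    (hli : LinearIndependent ℂ fun j => S' j x₀) (j : Fin n) : ContinuousAt (c j) x₀ := by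
  have := Fintype.ofFinite κ
  obtain ⟨L, hL⟩ := LinearMap.exists_leftInverse_of_injective
    (Fintype.linearCombination ℂ fun j => S' j x₀)
    (LinearMap.ker_eq_bot.2 (linearIndependent_iff_injective_fintypeLinearCombination.1 hli))
  have hLc : Continuous L := L.continuous_of_finiteDimensional
  let A : T → Matrix (Fin n) (Fin n) ℂ := fun x i k => L (S' i x) k
  have hA : ContinuousAt A x₀ := continuousAt_pi.2 fun i => continuousAt_pi.2 fun k =>
    (continuous_apply k).continuousAt.comp (hLc.continuousAt.comp (hS' i))
  have hA0 : A x₀ = 1 := by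
    ext i k
    have := LinearMap.congr_fun hL (Pi.single i 1)
    simp only [LinearMap.comp_apply, Fintype.linearCombination_apply_single, one_smul,
      LinearMap.id_apply] at this
    simp only [A, this, Matrix.one_apply, Pi.single_apply, eq_comm]
  have hdet : ContinuousAt (fun x => (A x).det) x₀ :=
    (continuous_id.matrix_det).continuousAt.comp hA
  have hadj : ContinuousAt (fun x => (A x).adjugate) x₀ :=
    (continuous_id.matrix_adjugate).continuousAt.comp hA
  have hne : ∀ᶠ x in nhds x₀, (A x).det ≠ 0 := by
    refine hdet.eventually_ne ?_
    simp [hA0]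
  have key : ContinuousAt
      (fun x => ((A x).det)⁻¹ * ∑ i, L (S x) i * (A x).adjugate i j) x₀ := by
    refine (hdet.inv₀ (by simp [hA0])).mul (tendsto_finsetSum _ fun i _ => ?_)
    exact ((continuous_apply i).continuousAt.comp (hLc.continuousAt.comp hS)).mul
      ((continuous_apply j).continuousAt.comp ((continuous_apply i).continuousAt.comp hadj))
  refine key.congr ?_
  filter_upwards [h, hne] with x hx hx'
  have h1 : L (S x) = Matrix.vecMul (fun l => c l x) (A x) := by
    rw [hx, map_sum]
    funext k
    simp [Matrix.vecMul, dotProduct, A, Finset.sum_apply]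
  have h2 : ∑ i, L (S x) i * (A x).adjugate i j =
      Matrix.vecMul (L (S x)) (A x).adjugate j := rfl
  rw [h2, h1, Matrix.vecMul_vecMul, Matrix.mul_adjugate, Matrix.vecMul_smul, Matrix.vecMul_one]
  simp [hx']

section

variable (W : GVB (times C M)) (P : C → Prop)

/-- Linear combinations of the members of local frames. -/
def comb (a : ∀ c : {c // P c}, (W.bdl c.1).A) (x : M) :
    ((Σ c, (W.bdl c.1).ι (a c)) → ℂ) →ₗ[ℂ] (∀ c : {c // P c}, (W.bdl c.1).E x) where
  toFun z c := ∑ i, z ⟨c, i⟩ • (W.bdl c.1).s (a c) i x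
  map_add' z w := by funext c; simp [add_smul, Finset.sum_add_distrib]
  map_smul' r z := by funext c; simp [mul_smul, Finset.smul_sum]

lemma comb_injective (a : ∀ c : {c // P c}, (W.bdl c.1).A) (x : M)
    (hx : ∀ c, x ∈ (W.bdl c.1).U (a c)) : Function.Injective (comb W P a x) := by
  intro z w h
  funext ⟨c, i⟩
  have := congrFun h c
  have h2 := linearIndependent_iff_injective_fintypeLinearCombination.1 ((W.bdl c.1).indep (a c) x (hx c))
  exact congrFun (@h2 (fun i => z ⟨c, i⟩) (fun i => w ⟨c, i⟩) this) i

variable {W P} in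
lemma LimFrame.exists_coord (φ : LimFrame W P) (a : ∀ c : {c // P c}, (W.bdl c.1).A)
    [Finite {c // P c}] (i : Fin φ.n) :
    ∃ S : M → (Σ c, (W.bdl c.1).ι (a c)) → ℂ, ∀ x ∈ φ.U, (∀ c, x ∈ (W.bdl c.1).U (a c)) →
      ContinuousAt S x ∧ (φ.s i x).1 = comb W P a x (S x) := by
  choose k hk h using fun c => φ.cont i c (a c)
  refine ⟨fun x q => k q.1 q.2 x, fun x hx hx' => ⟨continuousAt_pi.2 fun q => ?_, ?_⟩⟩
  · exact (hk q.1 q.2).continuousAt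
      ((φ.isOpen.inter ((W.bdl _).isOpen _)).mem_nhds ⟨hx, hx' _⟩)
  · funext c
    exact h c x ⟨hx, hx' c⟩

lemma LimFrame.compat [Finite {c // P c}] (φ φ' : LimFrame W P) (i : Fin φ.n) :
    ∃ c : Fin φ'.n → M → ℂ, (∀ j, ContinuousOn (c j) (φ.U ∩ φ'.U)) ∧
      ∀ x ∈ φ.U ∩ φ'.U, φ.s i x = ∑ j, c j x • φ'.s j x := by
  classical
  have h : ∀ x, ∃ c : Fin φ'.n → ℂ, x ∈ φ.U ∩ φ'.U → φ.s i x = ∑ j, c j • φ'.s j x := by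
    intro x
    by_cases hx : x ∈ φ.U ∩ φ'.U
    · obtain ⟨c, hc⟩ := (Submodule.mem_span_range_iff_exists_fun ℂ).1
        (φ'.spans x hx.2 (Submodule.mem_top (x := φ.s i x)))
      exact ⟨c, fun _ => hc.symm⟩
    · exact ⟨0, fun h => absurd h hx⟩
  choose c hc using h
  refine ⟨fun j x => c x j, fun j x₀ hx₀ => ContinuousAt.continuousWithinAt ?_, hc⟩
  choose a ha using fun d : {c // P c} => (W.bdl d.1).cover x₀
  obtain ⟨S, hS⟩ := φ.exists_coord a i
  choose S' hS' using fun j => φ'.exists_coord a j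
  have hnear : ∀ᶠ x in nhds x₀, (x ∈ φ.U ∩ φ'.U) ∧ ∀ d : {c // P c}, x ∈ (W.bdl d.1).U (a d) :=
    Filter.Eventually.and ((φ.isOpen.inter φ'.isOpen).mem_nhds hx₀)
      (Filter.eventually_all.2 fun d => ((W.bdl d.1).isOpen (a d)).mem_nhds (ha d))
  refine continuousAt_coef (S := S) (S' := S') (c := fun j x => c x j) (hS x₀ hx₀.1 ha).1
    (fun j => (hS' j x₀ hx₀.2 ha).1) ?_ ?_ j
  · filter_upwards [hnear] with x hx
    apply comb_injective W P a x hx.2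
    rw [← (hS x hx.1.1 hx.2).2, hc x hx.1, map_sum]
    simp only [map_smul, ← (hS' _ x hx.1.2 hx.2).2]
    simp
  · have h1 := φ'.indep x₀ hx₀.2
    have h2 := h1.map' (limFibre W P x₀).subtype (Submodule.ker_subtype _)
    refine LinearIndependent.of_comp (comb W P a x₀) ?_
    have h3 : (⇑(comb W P a x₀) ∘ fun j => S' j x₀) =
        ⇑(limFibre W P x₀).subtype ∘ fun i => φ'.s i x₀ :=
      funext fun j => ((hS' j x₀ hx₀.2 ha).2).symm
    rw [h3]
    exact h2

variable [Finite {c // P c}] [∀ c d : C, Finite (c ⟶ d)]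

/-- Averaging over all arrows, a projection to `limFibre`. -/
def avg (x : M) :
    (∀ c : {c // P c}, (W.bdl c.1).E x) →ₗ[ℂ] (∀ c : {c // P c}, (W.bdl c.1).E x) :=
  letI := Fintype.ofFinite {c // P c}
  letI := fun c d : C => Fintype.ofFinite (c ⟶ d)
  LinearMap.pi fun d => ((Fintype.card (Σ c : {c // P c}, (c.1 ⟶ d.1)) : ℂ)⁻¹) •
    ∑ q : Σ c : {c // P c}, (c.1 ⟶ d.1),
      (W.act q.2 (b := x) (b' := x) rfl).comp (LinearMap.proj q.1)

lemma avg_isProj (x : M) : LinearMap.IsProj (limFibre W P x) (avg W P x) := by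
  let := Fintype.ofFinite {c // P c}
  let := fun c d : C => Fintype.ofFinite (c ⟶ d)
  have hcard : ∀ d : {c // P c}, (Fintype.card (Σ c : {c // P c}, (c.1 ⟶ d.1)) : ℂ) ≠ 0 := by
    intro d
    have : Nonempty (Σ c : {c // P c}, (c.1 ⟶ d.1)) := ⟨⟨d, 𝟙 _⟩⟩
    exact_mod_cast Fintype.card_ne_zero
  constructor
  · intro v d e γ
    let ε : (Σ c : {c // P c}, (c.1 ⟶ d.1)) ≃ (Σ c : {c // P c}, (c.1 ⟶ e.1)) :=
      Equiv.sigmaCongrRight fun c =>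
        { toFun := fun f => f ≫ γ
          invFun := fun f => f ≫ Groupoid.inv γ
          left_inv := fun f => by simp
          right_inv := fun f => by simp }
    have h1 : (Fintype.card (Σ c : {c // P c}, (c.1 ⟶ d.1)) : ℂ) =
        Fintype.card (Σ c : {c // P c}, (c.1 ⟶ e.1)) := by rw [Fintype.card_congr ε]
    simp only [avg, LinearMap.pi_apply, LinearMap.smul_apply, LinearMap.sum_apply,
      LinearMap.comp_apply, LinearMap.proj_apply, map_smul, map_sum]
    rw [h1]
    congr 1
    refine Fintype.sum_equiv ε _ _ fun q => ?_
    exact (W.act_comp q.2 γ rfl rfl rfl _).symm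
  · intro v hv
    funext d
    simp only [avg, LinearMap.pi_apply, LinearMap.smul_apply, LinearMap.sum_apply,
      LinearMap.comp_apply, LinearMap.proj_apply]
    have : ∀ q : Σ c : {c // P c}, (c.1 ⟶ d.1),
        W.act q.2 (b := x) (b' := x) rfl (v q.1) = v d := fun q => hv _ _ _
    simp only [this, Finset.sum_const, Finset.card_univ, ← Nat.cast_smul_eq_nsmul ℂ, smul_smul]
    rw [inv_mul_cancel₀ (hcard d), one_smul]

/-- The matrix coefficients of the averaging projection are continuous. -/
lemma avg_coef (a : ∀ c : {c // P c}, (W.bdl c.1).A) (z : (Σ c, (W.bdl c.1).ι (a c)) → ℂ)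
    (d : {c // P c}) (a' : (W.bdl d.1).A) :
    ∃ k : (W.bdl d.1).ι a' → M → ℂ,
      (∀ j, ContinuousOn (k j) ({x | ∀ c, x ∈ (W.bdl c.1).U (a c)} ∩ (W.bdl d.1).U a')) ∧
      ∀ x ∈ {x | ∀ c, x ∈ (W.bdl c.1).U (a c)} ∩ (W.bdl d.1).U a',
        avg W P x (comb W P a x z) d = ∑ j, k j x • (W.bdl d.1).s a' j x := by
  let := Fintype.ofFinite {c // P c}
  let := fun c d : C => Fintype.ofFinite (c ⟶ d)
  choose k hk h using fun (q : Σ c : {c // P c}, (c.1 ⟶ d.1)) (i : (W.bdl q.1.1).ι (a q.1)) =>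
    W.act_cont q.2 (a q.1) a' i
  let dg : ∀ q : Σ c : {c // P c}, (c.1 ⟶ d.1), M → (times C M).Arr q.2 :=
    fun q x => ⟨(x, x), rfl⟩
  have hdg : ∀ q, Continuous (dg q) := fun q =>
    (continuous_id.prodMk continuous_id).subtype_mk _
  refine ⟨fun j x => (Fintype.card (Σ c : {c // P c}, (c.1 ⟶ d.1)) : ℂ)⁻¹ *
    ∑ q : Σ c : {c // P c}, (c.1 ⟶ d.1), ∑ i, z ⟨q.1, i⟩ * k q i j (dg q x), ?_, ?_⟩
  · intro j
    refine continuousOn_const.mul (continuousOn_finsetSum _ fun q _ =>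
      continuousOn_finsetSum _ fun i _ => continuousOn_const.mul ?_)
    exact (hk q i j).comp (hdg q).continuousOn fun x hx => ⟨hx.1 _, hx.2⟩
  · intro x hx
    have h' : ∀ (q : Σ c : {c // P c}, (c.1 ⟶ d.1)) (i : (W.bdl q.1.1).ι (a q.1)),
        W.act q.2 (b := x) (b' := x) rfl ((W.bdl q.1.1).s (a q.1) i x) =
          ∑ j, k q i j (dg q x) • (W.bdl d.1).s a' j x :=
      fun q i => h q i (dg q x) (hx.1 _) hx.2
    simp only [avg, comb, LinearMap.pi_apply, LinearMap.smul_apply, LinearMap.sum_apply,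
      LinearMap.comp_apply, LinearMap.proj_apply, LinearMap.coe_mk, AddHom.coe_mk, map_sum,
      map_smul, h', Finset.smul_sum, smul_smul]
    simp only [Finset.mul_sum, Finset.sum_smul]
    rw [Finset.sum_comm]
    simp only [Finset.sum_comm (t := (Finset.univ : Finset ((W.bdl d.1).ι a')))]

lemma trace_avg_continuousAt (x₀ : M) :
    ContinuousAt (fun x => LinearMap.trace ℂ _ (avg W P x)) x₀ := by
  classical
  let := Fintype.ofFinite {c // P c}
  choose a ha using fun c : {c // P c} => (W.bdl c.1).cover x₀
  have hV : IsOpen {x | ∀ c : {c // P c}, x ∈ (W.bdl c.1).U (a c)} := by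
    simp only [Set.ofPred_forall]
    exact isOpen_iInter_of_finite fun c => (W.bdl c.1).isOpen (a c)
  choose k hk h using fun (q : Σ c : {c // P c}, (W.bdl c.1).ι (a c)) =>
    avg_coef W P a (Pi.single q 1) q.1 (a q.1)
  have hcont : ContinuousAt (fun x => ∑ q : Σ c : {c // P c}, (W.bdl c.1).ι (a c), k q q.2 x) x₀ :=
    tendsto_finsetSum _ fun q _ => (hk q q.2).continuousAt
      ((hV.inter ((W.bdl _).isOpen _)).mem_nhds ⟨ha, ha _⟩)
  refine hcont.congr ?_
  filter_upwards [hV.mem_nhds ha] with x hx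
  let β := Pi.basis fun c : {c // P c} => (W.bdl c.1).basis (a c) x (hx c)
  rw [LinearMap.trace_eq_matrix_trace ℂ β, Matrix.trace]
  refine Finset.sum_congr rfl fun q _ => ?_
  have hβ : β q = comb W P a x (Pi.single q 1) := by
    obtain ⟨c, i⟩ := q
    funext d
    simp only [β, Pi.basis_apply, comb, LinearMap.coe_mk, AddHom.coe_mk]
    by_cases hcd : c = d
    · subst hcd
      simp [Pi.single_apply]
    · rw [Pi.single_eq_of_ne (Ne.symm hcd)]
      symm
      refine Finset.sum_eq_zero fun j _ => ?_
      rw [Pi.single_eq_of_ne, zero_smul]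
      intro he
      exact hcd (congrArg Sigma.fst he).symm
  rw [Matrix.diag_apply, LinearMap.toMatrix_apply, hβ, Pi.basis_repr, h q x ⟨hx, hx _⟩]
  simp only [← VB.basis_apply _ _ _ (hx q.1), map_sum, map_smul, Module.Basis.repr_self]
  simp [Finsupp.single_apply]

lemma LimFrame.exists_frame (x₀ : M) : ∃ φ : LimFrame W P, x₀ ∈ φ.U := by
  classical
  let := Fintype.ofFinite {c // P c}
  choose a ha using fun c : {c // P c} => (W.bdl c.1).cover x₀
  have hV : IsOpen {x | ∀ c : {c // P c}, x ∈ (W.bdl c.1).U (a c)} := by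
    simp only [Set.ofPred_forall]
    exact isOpen_iInter_of_finite fun c => (W.bdl c.1).isOpen (a c)
  have hfin : ∀ x ∈ {x | ∀ c : {c // P c}, x ∈ (W.bdl c.1).U (a c)},
      FiniteDimensional ℂ (∀ c : {c // P c}, (W.bdl c.1).E x) := fun x hx =>
    (Pi.basis fun c : {c // P c} => (W.bdl c.1).basis (a c) x (hx c)).finiteDimensional_of_finite
  have hrank : ∀ᶠ x in nhds x₀, Module.finrank ℂ (limFibre W P x) =
      Module.finrank ℂ (limFibre W P x₀) := by
    have h1 := trace_avg_continuousAt W P x₀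
    have h2 : ContinuousAt (fun x => (Module.finrank ℂ (limFibre W P x) : ℂ)) x₀ := by
      refine h1.congr ?_
      filter_upwards [hV.mem_nhds ha] with x hx
      have := hfin x hx
      exact (avg_isProj W P x).trace
    have h3 := h2.eventually (Metric.ball_mem_nhds _ one_pos)
    filter_upwards [h3] with x hx
    have hx' : |((Module.finrank ℂ (limFibre W P x) : ℤ) -
        (Module.finrank ℂ (limFibre W P x₀) : ℤ))| < 1 := by
      rw [Complex.dist_eq] at hx
      have : ‖((((Module.finrank ℂ (limFibre W P x) : ℤ) -
        (Module.finrank ℂ (limFibre W P x₀) : ℤ)) : ℤ) : ℂ)‖ < 1 := by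
        push_cast; exact hx
      rw [Complex.norm_intCast] at this
      exact_mod_cast this
    have := Int.abs_lt_one_iff.1 hx'
    omega
  have hfin₀ := hfin x₀ ha
  let w := Module.finBasis ℂ (limFibre W P x₀)
  let β := Pi.basis fun c : {c // P c} => (W.bdl c.1).basis (a c) x₀ (ha c)
  let z : Fin (Module.finrank ℂ (limFibre W P x₀)) → (Σ c : {c // P c}, (W.bdl c.1).ι (a c)) → ℂ :=
    fun i q => β.repr (w i).1 q
  have hz : ∀ i, comb W P a x₀ (z i) = (w i).1 := by
    intro i
    funext c
    simp only [comb, z, β, LinearMap.coe_mk, AddHom.coe_mk, Pi.basis_repr]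
    simp only [← VB.basis_apply _ _ _ (ha c)]
    exact ((W.bdl c.1).basis (a c) x₀ (ha c)).sum_repr _
  let s : Fin (Module.finrank ℂ (limFibre W P x₀)) → ∀ x, limFibre W P x :=
    fun i x => ⟨avg W P x (comb W P a x (z i)), (avg_isProj W P x).map_mem _⟩
  have hs₀ : ∀ i, s i x₀ = w i := by
    intro i
    refine Subtype.ext ?_
    change avg W P x₀ (comb W P a x₀ (z i)) = _
    rw [hz]
    exact (avg_isProj W P x₀).map_id _ (w i).2
  choose k hk h using fun i (d : {c // P c}) => avg_coef W P a (z i) d (a d)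
  let S : M → Fin (Module.finrank ℂ (limFibre W P x₀)) →
      (Σ c : {c // P c}, (W.bdl c.1).ι (a c)) → ℂ := fun x i q => k i q.1 q.2 x
  have hScomb : ∀ x ∈ {x | ∀ c : {c // P c}, x ∈ (W.bdl c.1).U (a c)}, ∀ i,
      (s i x).1 = comb W P a x (S x i) := by
    intro x hx i
    funext d
    exact h i d x ⟨hx, hx d⟩
  have hScont : ContinuousAt S x₀ := by
    refine continuousAt_pi.2 fun i => continuousAt_pi.2 fun q => ?_
    exact (hk i q.1 q.2).continuousAt ((hV.inter ((W.bdl _).isOpen _)).mem_nhds ⟨ha, ha _⟩)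
  have hSli : LinearIndependent ℂ (S x₀) := by
    refine LinearIndependent.of_comp (comb W P a x₀) ?_
    have h3 : (⇑(comb W P a x₀) ∘ S x₀) = ⇑(limFibre W P x₀).subtype ∘ w := by
      funext i
      simp only [Function.comp_apply, ← hScomb x₀ ha i, hs₀]
      rfl
    rw [h3]
    exact w.linearIndependent.map' _ (Submodule.ker_subtype _)
  have hSli' : ∀ᶠ x in nhds x₀, LinearIndependent ℂ (S x) :=
    hScont.eventually (isOpen_setOfPred_linearIndependent.mem_nhds hSli)
  obtain ⟨U, hU, hUo, hU₀⟩ := eventually_nhds_iff.1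
    (Filter.Eventually.and (hV.mem_nhds ha) (hrank.and hSli'))
  have hli : ∀ x ∈ U, LinearIndependent ℂ fun i => s i x := by
    intro x hx
    refine LinearIndependent.of_comp (limFibre W P x).subtype ?_
    have h3 : (⇑(limFibre W P x).subtype ∘ fun i => s i x) = ⇑(comb W P a x) ∘ S x := by
      funext i
      exact hScomb x (hU x hx).1 i
    rw [h3]
    exact (hU x hx).2.2.map' _ (LinearMap.ker_eq_bot.2 (comb_injective W P a x (hU x hx).1))
  refine ⟨{ U := U, n := _, s := s, isOpen := hUo, indep := hli, spans := ?_, cont := ?_ }, hU₀⟩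
  · intro x hx
    have := hfin x (hU x hx).1
    refine ((hli x hx).span_eq_top_of_card_eq_finrank' ?_).ge
    rw [Fintype.card_fin, (hU x hx).2.1]
  · intro i d a'
    obtain ⟨l, hl, hl'⟩ := avg_coef W P a (z i) d a'
    exact ⟨l, fun j => (hl j).mono fun x hx => ⟨(hU x hx.1).1, hx.2⟩,
      fun x hx => hl' x ⟨(hU x hx.1).1, hx.2⟩⟩

/-- The transfer along the projection from `{c // P c} × M` to `M`. -/
def transfer : VB M where
  E x := limFibre W P x
  A := LimFrame W P
  U φ := φ.U
  ι φ := Fin φ.n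
  s φ := φ.s
  isOpen φ := φ.isOpen
  cover := LimFrame.exists_frame W P
  indep φ := φ.indep
  spans φ := φ.spans
  compat φ φ' := LimFrame.compat W P φ φ'

end

end Transfer

/-! ## Power operations -/

/-- The map of tensor products `⨂ᵢ vᵢ ↦ ⨂ⱼ L j (v (ρ j))`. -/
def permTensor {m n : ℕ} {E : Fin n → Type} {F : Fin m → Type}
    [∀ i, AddCommGroup (E i)] [∀ i, Module ℂ (E i)] [∀ j, AddCommGroup (F j)]
    [∀ j, Module ℂ (F j)] (ρ : Fin m ≃ Fin n) (L : ∀ j, E (ρ j) →ₗ[ℂ] F j) :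
    PiTensorProduct ℂ E →ₗ[ℂ] PiTensorProduct ℂ F :=
  have key : ∀ (_ : DecidableEq (Fin n)) (v : ∀ i, E i) (j₀ : Fin m) (x : E (ρ j₀)),
      (fun j => L j (Function.update v (ρ j₀) x (ρ j))) =
        Function.update (fun j => L j (v (ρ j))) j₀ (L j₀ x) := by
    intro _ v j₀ x
    funext j
    by_cases h : j = j₀
    · subst h; simp
    · rw [Function.update_of_ne (ρ.injective.ne h), Function.update_of_ne h]
  PiTensorProduct.lift
    { toFun := fun v => PiTensorProduct.tprod ℂ fun j => L j (v (ρ j))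
      map_update_add' := fun v i x y => by
        obtain ⟨j₀, rfl⟩ := ρ.surjective i
        simp only [key, map_add, MultilinearMap.map_update_add]
      map_update_smul' := fun v i c x => by
        obtain ⟨j₀, rfl⟩ := ρ.surjective i
        simp only [key, map_smul, MultilinearMap.map_update_smul] }

@[simp] lemma permTensor_tprod {m n : ℕ} {E : Fin n → Type} {F : Fin m → Type}
    [∀ i, AddCommGroup (E i)] [∀ i, Module ℂ (E i)] [∀ j, AddCommGroup (F j)]
    [∀ j, Module ℂ (F j)] (ρ : Fin m ≃ Fin n) (L : ∀ j, E (ρ j) →ₗ[ℂ] F j) (v : ∀ i, E i) :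
    permTensor ρ L (PiTensorProduct.tprod ℂ v) =
      PiTensorProduct.tprod ℂ fun j => L j (v (ρ j)) := by
  simp [permTensor]

/-- The total Atiyah power operation: on the component `Sₙ ∫ X` of `S(X)`, the bundle `P(V)` is the
`n`th external tensor power of `V`, and permutations act by permuting the tensor factors. -/
def GVB.power {X : TGpd.{u}} (V : GVB X) : GVB (Sym X) where
  bdl x := VB.extTensor fun i => V.bdl (x.c i)
  act {x y} (f : SymHom x y) {b b'} h :=
    permTensor (E := fun i => (V.bdl (x.c i)).E (b i)) (F := fun j => (V.bdl (y.c j)).E (b' j))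
      f.perm fun j => V.act (f.hom j) (b := b (f.perm j)) (b' := b' j) (congrFun h j)
  act_cont {x y} (f : SymHom x y) a a' k := by
    choose c hc h using fun j => V.act_cont (f.hom j) (a (f.perm j)) (a' j) (k (f.perm j))
    let r : ∀ j, (Sym X).Arr (c := x) (d := y) f → X.Arr (f.hom j) :=
      fun j q => ⟨(q.1.1 (f.perm j), q.1.2 j), congrFun q.2 j⟩
    have hr : ∀ j, Continuous (r j) := fun j => Continuous.subtype_mk
      (((continuous_apply _).comp (continuous_fst.comp continuous_subtype_val)).prodMk
        ((continuous_apply _).comp (continuous_snd.comp continuous_subtype_val))) _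
    refine ⟨fun l q => ∏ j, c j (l j) (r j q), fun l => ?_, fun q hq hq' => ?_⟩
    · exact continuousOn_finsetProd _ fun j _ =>
        (hc j (l j)).comp (hr j).continuousOn fun q hq => ⟨hq.1 (f.perm j), hq.2 j⟩
    · have h2 : (fun j => V.act (f.hom j) (b := q.1.1 (f.perm j)) (b' := q.1.2 j) (congrFun q.2 j)
          ((V.bdl (x.c (f.perm j))).s (a (f.perm j)) (k (f.perm j)) (q.1.1 (f.perm j)))) =
          fun j => ∑ l, c j l (r j q) • (V.bdl (y.c j)).s (a' j) l (q.1.2 j) :=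
        funext fun j => h j (r j q) (hq (f.perm j)) (hq' j)
      refine (permTensor_tprod _ _ _).trans ?_
      rw [h2, MultilinearMap.map_sum]
      simp_rw [MultilinearMap.map_smul_univ]
      rfl
  act_id {x b} h v := by
    refine LinearMap.congr_fun
      (f := permTensor (E := fun i => (V.bdl (x.c i)).E (b i))
        (F := fun i => (V.bdl (x.c i)).E (b i)) (Equiv.refl _)
        fun j => V.act (𝟙 (x.c j)) (b := b j) (b' := b j) (congrFun h j))
      (g := LinearMap.id) ?_ v
    refine PiTensorProduct.ext (MultilinearMap.ext fun w => ?_)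
    exact (permTensor_tprod (Equiv.refl _) _ w).trans
      (congrArg (PiTensorProduct.tprod ℂ) (funext fun j => V.act_id (congrFun h j) _))
  act_comp {x y z} (f : SymHom x y) (g : SymHom y z) {b b' b''} h h' h'' v := by
    refine LinearMap.congr_fun
      (f := permTensor (E := fun i => (V.bdl (x.c i)).E (b i))
        (F := fun j => (V.bdl (z.c j)).E (b'' j)) (g.perm.trans f.perm)
        fun j => V.act (f.hom (g.perm j) ≫ g.hom j) (b := b (f.perm (g.perm j))) (b' := b'' j)
          (congrFun h'' j))
      (g := (permTensor (E := fun i => (V.bdl (y.c i)).E (b' i))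
        (F := fun j => (V.bdl (z.c j)).E (b'' j)) g.perm
          fun j => V.act (g.hom j) (b := b' (g.perm j)) (b' := b'' j) (congrFun h' j)).comp
        (permTensor (E := fun i => (V.bdl (x.c i)).E (b i))
          (F := fun j => (V.bdl (y.c j)).E (b' j)) f.perm
            fun j => V.act (f.hom j) (b := b (f.perm j)) (b' := b' j) (congrFun h j))) ?_ v
    refine PiTensorProduct.ext (MultilinearMap.ext fun w => ?_)
    simp only [LinearMap.compMultilinearMap_apply, LinearMap.comp_apply, permTensor_tprod]
    exact (permTensor_tprod (g.perm.trans f.perm) _ w).trans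
      (congrArg (PiTensorProduct.tprod ℂ)
        (funext fun j => V.act_comp _ _ (congrFun h (g.perm j)) _ _ _))

section Space

variable {M : Type u} [TopologicalSpace M]

/-- Transport between fibres over equal points. -/
def VB.cast (V : VB M) {x y : M} (h : x = y) : V.E x →ₗ[ℂ] V.E y := h ▸ LinearMap.id

lemma VB.cast_s (V : VB M) {x y : M} (h : x = y) (a : V.A) (i : V.ι a) :
    V.cast h (V.s a i x) = V.s a i y := by
  subst h; rfl

lemma VB.cast_rfl (V : VB M) {x : M} (h : x = x) (v : V.E x) : V.cast h v = v := rfl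

lemma VB.cast_cast (V : VB M) {x y z : M} (h : x = y) (h' : y = z) (h'' : x = z) (v : V.E x) :
    V.cast h'' v = V.cast h' (V.cast h v) := by
  subst h h'; rfl

/-- Pull-back to a groupoid `X` of a vector bundle on a space `M`, along a map `X → M` that is
invariant under the arrows of `X`; the arrows act by identity maps. -/
def VB.toGVB (V : VB M) (X : TGpd.{u}) (f : ∀ c, X.fib c → M) (hf : ∀ c, Continuous (f c))
    (hinv : ∀ {c d : X.Ix} (γ : c ⟶ d) (b : X.fib c), f d (X.tr γ b) = f c b) : GVB X where
  bdl c := V.pullback (f c) (hf c)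
  act {c d} γ {b b'} h := V.cast (by rw [← h, hinv])
  act_cont {c d} γ a a' i := by
    obtain ⟨k, hk, h⟩ := V.compat a.down a'.down i
    have hfq : ∀ q : X.Arr γ, f c q.1.1 = f d q.1.2 := fun q => by rw [← q.2, hinv]
    refine ⟨fun j q => k j (f c q.1.1), fun j => ?_, fun q hq hq' => ?_⟩
    · exact (hk j).comp
        ((hf c).comp (continuous_fst.comp continuous_subtype_val)).continuousOn
        fun q hq => ⟨hq.1, by rw [hfq]; exact hq.2⟩
    · change V.cast _ (V.s a.down i (f c q.1.1)) = ∑ j, k j (f c q.1.1) • V.s a'.down j (f d q.1.2)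
      have hq'' : f c q.1.1 ∈ V.U a'.down := by rw [hfq]; exact hq'
      rw [h (f c q.1.1) ⟨hq, hq''⟩, map_sum]
      exact Finset.sum_congr rfl fun j _ => by rw [map_smul, V.cast_s (hfq q)]
  act_id h v := rfl
  act_comp γ δ _ _ _ h h' h'' v := V.cast_cast _ _ _ v

/-- A vector bundle on a space, viewed as a vector bundle on a groupoid. -/
def VB.ofSpace (V : VB M) : GVB (space M) :=
  V.toGVB (space M) (fun _ x => x) (fun _ => continuous_id) fun _ _ => rfl

/-! ### The additive operation `θ` -/

lemma phi_const (p : (Phi (space M)).Ix) (b : (Phi (space M)).fib p) (i j : Fin p.z.x.n) :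
    b.1 i = b.1 j := by
  obtain ⟨⟨⟨n, c⟩, g⟩, pos, rot⟩ := p
  obtain ⟨b, hb⟩ := b
  have h : ∀ i, b ((finRotate n).symm i) = b i := by
    intro i
    have := congrFun hb i
    rw [← show (SymHom.perm g) = _ from rot]
    exact this
  obtain ⟨m, rfl⟩ : ∃ m, n = m + 1 := ⟨n - 1, by dsimp only at pos; omega⟩
  have h0 : ∀ i : Fin (m + 1), b i = b 0 := by
    intro i
    induction i using Fin.induction with
    | zero => rfl
    | succ i ih =>
      rw [← ih, ← h i.succ]
      congr 1
      rw [Equiv.symm_apply_eq]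
      simp
  exact (h0 i).trans (h0 j).symm

/-- The operation `θ`, on a vector bundle `V` on a space `M`, viewed as the power series `V q⁰`.
For a space, `Φ_k(M)` consists of the constant `k`-tuples, `E_k` sends such a tuple to its first
entry, and `s_k` sends `V q⁰` to `V q^(0/k)`, on which the `k`th root of the centre element acts by
`exp(2πi · 0/k) = 1`; so all the arrows of `Φ_k(M)` act on `θ(V) = E_k^* s_k V` by identity maps. -/
def VB.theta (V : VB M) : GVB (Phi (space M)) :=
  V.toGVB (Phi (space M)) (fun p b => b.1 ⟨0, p.pos⟩)
    (fun _ => (continuous_apply _).comp continuous_subtype_val)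
    (fun {p q} γ b => by
      change b.1 (SymHom.perm γ.1 ⟨0, q.pos⟩) = b.1 ⟨0, p.pos⟩
      exact phi_const p b _ _)

/-! ### The equivalence `Q : S(Φ(M)) → Λ(S(M))` -/

/-- The number `k` of entries of an object of `Φ_k`. -/
abbrev PhiIx.len (p : PhiIx Pt) : ℕ := p.z.x.n

/-- The permutation that underlies an arrow of `Φ(pt)`. -/
abbrev PhiIx.perm {p q : PhiIx Pt} (f : p ⟶ q) : Fin q.len ≃ Fin p.len :=
  SymHom.perm (show SymHom p.z.x q.z.x from f.1)

/-- The numbering of the entries of the concatenation of a list of objects of `Φ`. -/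
def slots (x : SymIx (PhiIx Pt)) : (Σ i, Fin (x.c i).len) ≃ Fin (∑ i, (x.c i).len) :=
  finSigmaFinEquiv

/-- Concatenation of a list of objects of `Φ(pt)`. -/
def concatObj (x : SymIx (PhiIx Pt)) : InIx (SymIx Pt) where
  x := ⟨∑ i, (x.c i).len, fun _ => ⟨⟩⟩
  g := (⟨((slots x).symm.trans (Equiv.sigmaCongrRight fun i => (x.c i).z.g.perm)).trans (slots x),
    fun _ => ()⟩ : SymHom _ _)

/-- The block permutation of a list of arrows in `Φ(pt)`. -/
def concatPerm {x y : SymIx (PhiIx Pt)} (f : SymHom x y) :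
    Fin (∑ j, (y.c j).len) ≃ Fin (∑ i, (x.c i).len) :=
  ((slots y).symm.trans (Equiv.sigmaCongr f.perm fun j => PhiIx.perm (f.hom j))).trans (slots x)

lemma concatObj_perm (x : SymIx (PhiIx Pt)) (i : Fin x.n) (l : Fin (x.c i).len) :
    SymHom.perm (concatObj x).g (slots x ⟨i, l⟩) = slots x ⟨i, (x.c i).z.g.perm l⟩ := by
  change slots x (Equiv.sigmaCongrRight (fun i => (x.c i).z.g.perm) ((slots x).symm (slots x ⟨i, l⟩))) = _
  rw [Equiv.symm_apply_apply]
  rfl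

lemma concatPerm_slots {x y : SymIx (PhiIx Pt)} (f : SymHom x y) (j : Fin y.n)
    (l : Fin (y.c j).len) :
    concatPerm f (slots y ⟨j, l⟩) = slots x ⟨f.perm j, PhiIx.perm (f.hom j) l⟩ := by
  change slots x (Equiv.sigmaCongr _ _ ((slots y).symm (slots y ⟨j, l⟩))) = _
  rw [Equiv.symm_apply_apply]
  rfl

lemma symHom_pt_ext {x y : SymIx Pt} {f g : SymHom x y} (h : ∀ j, f.perm j = g.perm j) :
    f = g :=
  SymHom.ext' h fun _ => rfl

/-- The functor `S(Φ(pt)) ⥤ Λ(S(pt))` which sends a list of long cycles to its concatenation. -/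
def concat : SymIx (PhiIx Pt) ⥤ InIx (SymIx Pt) where
  obj := concatObj
  map {x y} f := ⟨(⟨concatPerm f, fun _ => ()⟩ : SymHom (concatObj x).x (concatObj y).x), by
    refine symHom_pt_ext fun j => ?_
    obtain ⟨⟨j, l⟩, rfl⟩ := (slots y).surjective j
    have h : (x.c (f.perm j)).z.g.perm (PhiIx.perm (f.hom j) l) =
        PhiIx.perm (f.hom j) ((y.c j).z.g.perm l) :=
      DFunLike.congr_fun (congrArg SymHom.perm (f.hom j).2) l
    change SymHom.perm (concatObj x).g (concatPerm f (slots y ⟨j, l⟩)) =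
      concatPerm f (SymHom.perm (concatObj y).g (slots y ⟨j, l⟩))
    rw [concatPerm_slots, concatObj_perm, concatObj_perm, concatPerm_slots, h]⟩
  map_id x := by
    refine Subtype.ext (symHom_pt_ext fun j => ?_)
    obtain ⟨⟨j, l⟩, rfl⟩ := (slots x).surjective j
    exact concatPerm_slots (𝟙 x : x ⟶ x) j l
  map_comp {x y z} f g := by
    refine Subtype.ext (symHom_pt_ext fun j => ?_)
    obtain ⟨⟨j, l⟩, rfl⟩ := (slots z).surjective j
    change concatPerm (f ≫ g : x ⟶ z) (slots z ⟨j, l⟩) =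
      concatPerm f (concatPerm g (slots z ⟨j, l⟩))
    rw [concatPerm_slots g, concatPerm_slots f]
    exact concatPerm_slots (f ≫ g : x ⟶ z) j l

variable (M) in
/-- The functor `Q : S(Φ(M)) → Λ(S(M))`, concatenation. -/
def Q : TFun (Sym (Phi (space M))) (Inertia (Sym (space M))) where
  ix := concat
  map x b := ⟨fun j => (b ((slots x).symm j).1).1 ((slots x).symm j).2, by
    have key : ∀ q : Σ i, Fin (x.c i).len,
        (fun q : Σ i, Fin (x.c i).len => (b q.1).1 q.2)
          ((slots x).symm (SymHom.perm (concatObj x).g (slots x q))) =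
        (fun q : Σ i, Fin (x.c i).len => (b q.1).1 q.2) ((slots x).symm (slots x q)) := by
      rintro ⟨i, l⟩
      rw [concatObj_perm, Equiv.symm_apply_apply, Equiv.symm_apply_apply]
      exact congrFun (b i).2 l
    funext j
    obtain ⟨q, rfl⟩ := (slots x).surjective j
    exact key q⟩
  map_cont x := by
    have h : ∀ i, Continuous fun b : (Sym (Phi (space M))).fib x => (b i).1 := fun i =>
      continuous_subtype_val.comp (continuous_apply i)
    exact Continuous.subtype_mk (continuous_pi fun j =>
      (continuous_apply ((slots x).symm j).2).comp (h ((slots x).symm j).1)) _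
  map_tr {x y} f b := by
    have key : ∀ q : Σ i, Fin (y.c i).len,
        (fun q : Σ i, Fin (x.c i).len => (b q.1).1 q.2)
          ((slots x).symm (concatPerm f (slots y q))) =
        (fun q : Σ i, Fin (y.c i).len => ((Sym (Phi (space M))).tr f b q.1).1 q.2)
          ((slots y).symm (slots y q)) := by
      rintro ⟨i, l⟩
      rw [concatPerm_slots, Equiv.symm_apply_apply, Equiv.symm_apply_apply]
    refine Subtype.ext (funext fun j => ?_)
    obtain ⟨q, rfl⟩ := (slots y).surjective j
    exact key q

/-! ### The total power operation in Tate `K`-theory -/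

/-- The rotation condition for the coefficient of `q⁰` in `K_rot(Λ(X), ξ)`: the centre element `ξ`,
which at the object `(x, g)` is the arrow `g`, acts with eigenvalue `exp(2πi · 0) = 1`. -/
def IsRot {X : TGpd.{u}} (W : GVB (Inertia X)) : Prop :=
  ∀ (z : (Inertia X).Ix) (b : (Inertia X).fib z) (v : (W.bdl z).E b),
    W.act (c := z) (d := z) ⟨z.g, rfl⟩ (b := b) (b' := b) (Subtype.ext b.2) v = v

/-- `W` represents `P^Tate(V) = (Q^*)⁻¹ P(θ(V))`. -/
def IsPTate (V : VB M) (W : GVB (Inertia (Sym (space M)))) : Prop :=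
  IsRot W ∧ (W.pullback (Q M)).Iso V.theta.power

/-- The total power operation in Tate `K`-theory, `P^Tate(V) = (Q^*)⁻¹ P(θ(V))` (a representative
of this isomorphism class of vector bundles on `Λ(S(M))`), for a vector bundle `V` on a space `M`,
viewed as the power series `V q⁰`. -/
def VB.pTate (V : VB M) : GVB (Inertia (Sym (space M))) :=
  Classical.epsilon (IsPTate V)

/-! ### Symmetric powers -/

variable (M) in
/-- The diagonal functor `δ : S(pt) × M → S(M)`. -/
def diag : TFun (times (SymIx Pt) M) (Sym (space M)) where
  ix := 𝟭 _
  map _ x := fun _ => x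
  map_cont _ := continuous_pi fun _ => continuous_id
  map_tr _ _ := rfl

variable (M) in
/-- The functor `Λ(δ) : Λ(S(pt)) × M = Λ(S(pt) × M) → Λ(S(M))`. -/
def diagInertia : TFun (times (InIx (SymIx Pt)) M) (Inertia (Sym (space M))) where
  ix := 𝟭 _
  map _ x := ⟨fun _ => x, rfl⟩
  map_cont _ := (continuous_pi fun _ => continuous_id).subtype_mk _
  map_tr _ _ := rfl

instance (x y : SymIx Pt) : Finite (x ⟶ y) :=
  Finite.of_injective (fun f : SymHom x y => f.perm) fun _ _ h =>
    symHom_pt_ext fun j => DFunLike.congr_fun h j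

instance (n : ℕ) : Finite {x : SymIx Pt // x.n = n} :=
  Finite.of_injective (fun _ => ()) fun x y _ => by
    obtain ⟨⟨m, c⟩, hx⟩ := x
    obtain ⟨⟨m', d⟩, hy⟩ := y
    dsimp only at hx hy
    subst hx hy
    obtain rfl : c = d := funext fun _ => rfl
    rfl

instance (z w : InIx (SymIx Pt)) : Finite (z ⟶ w) :=
  inferInstanceAs (Finite {f : z.x ⟶ w.x // z.g ≫ f = f ≫ w.g})

instance (n : ℕ) : Finite {z : InIx (SymIx Pt) // z.x.n = n} :=
  Finite.of_injective
    (fun z => (⟨⟨z.1.x, z.2⟩, z.1.g⟩ : Σ x : {x : SymIx Pt // x.n = n}, (x.1 ⟶ x.1))) fun z w h => by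
      obtain ⟨⟨x, g⟩, hx⟩ := z
      obtain ⟨⟨y, k⟩, hy⟩ := w
      simp only [Sigma.mk.injEq, Subtype.mk.injEq] at h
      obtain ⟨rfl, h⟩ := h
      obtain rfl := eq_of_heq h
      rfl

/-- The coefficient of `tⁿ` of the total symmetric power `S_t(V) = ε_! δ^* P(V)` in `K`-theory,
where `ε : S(pt) × M → ℕ × M` is the augmentation. -/
def VB.symPow (V : VB M) (n : ℕ) : VB M :=
  transfer (V.ofSpace.power.pullback (diag M)) fun x => x.n = n

/-- The coefficient of `tⁿ` of the total symmetric power `S_t^Tate(V) = (Λε)_! (Λδ)^* P^Tate(V)` in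
Tate `K`-theory. -/
def VB.symPowTate (V : VB M) (n : ℕ) : VB M :=
  transfer (V.pTate.pullback (diagInertia M)) fun z => z.x.n = n

/-- The class in `K_Tate(M)` of a vector bundle on `M`, viewed as the power series `V q⁰`. -/
def VB.clsTate (V : VB M) : KTate M := PowerSeries.C V.cls

/-- The total (Atiyah) symmetric power `S_t(V)` in `K_Tate(M)⟦t⟧`. -/
def VB.S (V : VB M) : PowerSeries (KTate M) :=
  PowerSeries.mk fun n => (V.symPow n).clsTate

/-- The total symmetric power `S_t^Tate(V)` in `K_Tate(M)⟦t⟧`. -/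
def VB.STate (V : VB M) : PowerSeries (KTate M) :=
  PowerSeries.mk fun n => (V.symPowTate n).clsTate

end Space

/-- The power series `F k`, `k ≥ 1`, have the (unconditional, `t`-adically convergent) infinite
product `G`: every coefficient of the finite partial products eventually equals that of `G`. -/
def HasFormalProd {R : Type*} [CommRing R] (F : ℕ+ → PowerSeries R) (G : PowerSeries R) : Prop :=
  ∀ n, ∀ᶠ s : Finset ℕ+ in Filter.atTop, PowerSeries.coeff n (∏ k ∈ s, F k) = PowerSeries.coeff n G

end TateK

end

noncomputable section

namespace TateK

universe u

open Filter Topology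

namespace VB

variable {B B' : Type u} [TopologicalSpace B] [TopologicalSpace B'] {E F G : VB B}

/-- Continuity at a point of a section of a vector bundle: near this point, the coefficients in
some local frame are continuous at the point. -/
def SecAt (E : VB B) (σ : ∀ b, E.E b) (b₀ : B) : Prop :=
  ∃ a, b₀ ∈ E.U a ∧ ∃ c : E.ι a → B → ℂ, (∀ j, ContinuousAt (c j) b₀) ∧
    ∀ᶠ b in 𝓝 b₀, σ b = ∑ j, c j b • E.s a j b

lemma eventually_mem_U (E : VB B) {a : E.A} {b₀ : B} (ha : b₀ ∈ E.U a) :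
    ∀ᶠ b in 𝓝 b₀, b ∈ E.U a :=
  (E.isOpen a).mem_nhds ha

lemma SecAt.congr {σ τ : ∀ b, E.E b} {b₀ : B} (h : E.SecAt σ b₀) (e : ∀ᶠ b in 𝓝 b₀, τ b = σ b) :
    E.SecAt τ b₀ := by
  obtain ⟨a, ha, c, hc, h⟩ := h
  exact ⟨a, ha, c, hc, by filter_upwards [e, h] with b h1 h2; rw [h1, h2]⟩

/-- The coefficients of a continuous section in any local frame are continuous. -/
lemma SecAt.coef {σ : ∀ b, E.E b} {b₀ : B} (h : E.SecAt σ b₀) {a : E.A} (ha : b₀ ∈ E.U a) :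
    ∃ c : E.ι a → B → ℂ, (∀ j, ContinuousAt (c j) b₀) ∧
      ∀ᶠ b in 𝓝 b₀, σ b = ∑ j, c j b • E.s a j b := by
  obtain ⟨a', ha', c, hc, h⟩ := h
  choose d hd hd' using E.compat a' a
  refine ⟨fun j b => ∑ i, c i b * d i j b, fun j => ?_, ?_⟩
  · exact tendsto_finsetSum _ fun i _ => (hc i).mul
      ((hd i j).continuousAt (((E.isOpen a').inter (E.isOpen a)).mem_nhds ⟨ha', ha⟩))
  · filter_upwards [h, E.eventually_mem_U ha, E.eventually_mem_U ha'] with b h1 h2 h3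
    rw [h1]
    simp only [hd' _ b ⟨h3, h2⟩, Finset.smul_sum, smul_smul, Finset.sum_smul]
    exact Finset.sum_comm

lemma secAt_frame (E : VB B) {a : E.A} {b₀ : B} (ha : b₀ ∈ E.U a) (i : E.ι a) :
    E.SecAt (E.s a i) b₀ := by
  classical
  refine ⟨a, ha, fun j _ => if i = j then 1 else 0, fun _ => continuousAt_const, .of_forall fun b => ?_⟩
  simp

lemma SecAt.sum {κ : Type*} [Fintype κ] {σ : κ → ∀ b, E.E b} {c : κ → B → ℂ} {b₀ : B}
    (hc : ∀ k, ContinuousAt (c k) b₀) (h : ∀ k, E.SecAt (σ k) b₀) :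
    E.SecAt (fun b => ∑ k, c k b • σ k b) b₀ := by
  obtain ⟨a, ha⟩ := E.cover b₀
  choose d hd hd' using fun k => (h k).coef ha
  refine ⟨a, ha, fun j b => ∑ k, c k b * d k j b, fun j =>
    tendsto_finsetSum _ fun k _ => (hc k).mul (hd k j), ?_⟩
  filter_upwards [eventually_all.2 hd'] with b hb
  simp only [hb, Finset.smul_sum, smul_smul, Finset.sum_smul]
  exact Finset.sum_comm

/-- A continuous morphism of vector bundles on `B`. -/
def Mor (E F : VB B) (f : ∀ b, E.E b →ₗ[ℂ] F.E b) : Prop :=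
  ContHom E F id id f

lemma contHom_iff {T : Type*} [TopologicalSpace T] {p : T → B} {p' : T → B'} {F : VB B'}
    {f : ∀ t, E.E (p t) →ₗ[ℂ] F.E (p' t)} (hp : Continuous p) (hp' : Continuous p') :
    ContHom E F p p' f ↔ ∀ a a' i t₀, p t₀ ∈ E.U a → p' t₀ ∈ F.U a' →
      ∃ c : F.ι a' → T → ℂ, (∀ j, ContinuousAt (c j) t₀) ∧
        ∀ᶠ t in 𝓝 t₀, f t (E.s a i (p t)) = ∑ j, c j t • F.s a' j (p' t) := by
  have ho : ∀ a a', IsOpen {t | p t ∈ E.U a ∧ p' t ∈ F.U a'} := fun a a' =>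
    ((E.isOpen a).preimage hp).inter ((F.isOpen a').preimage hp')
  constructor
  · intro h a a' i t₀ ht ht'
    obtain ⟨c, hc, h⟩ := h a a' i
    refine ⟨c, fun j => (hc j).continuousAt ((ho a a').mem_nhds ⟨ht, ht'⟩), ?_⟩
    filter_upwards [(ho a a').mem_nhds ⟨ht, ht'⟩] with t ht
    exact h t ht.1 ht.2
  · intro h a a' i
    classical
    let d : F.ι a' → T → ℂ := fun j t =>
      if ht : p' t ∈ F.U a' then (F.basis a' _ ht).repr (f t (E.s a i (p t))) j else 0
    refine ⟨d, fun j t₀ ht₀ => ContinuousAt.continuousWithinAt ?_, fun t _ ht => ?_⟩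
    · obtain ⟨c, hc, h⟩ := h a a' i t₀ ht₀.1 ht₀.2
      refine (hc j).congr ?_
      filter_upwards [h, (ho a a').mem_nhds ht₀] with t h1 h2
      simp only [d, dif_pos h2.2, h1]
      simp only [← F.basis_apply a' _ h2.2, map_sum, map_smul, Module.Basis.repr_self]
      simp [Finsupp.single_apply]
    · simp only [d, dif_pos ht]
      exact ((F.basis a' _ ht).sum_repr (f t (E.s a i (p t)))).symm.trans
        (Finset.sum_congr rfl fun _ _ => by rw [basis_apply])

lemma Mor.secAt {f : ∀ b, E.E b →ₗ[ℂ] F.E b} (hf : Mor E F f) {σ : ∀ b, E.E b} {b₀ : B}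
    (h : E.SecAt σ b₀) : F.SecAt (fun b => f b (σ b)) b₀ := by
  obtain ⟨a, ha, c, hc, h⟩ := h
  obtain ⟨a', ha'⟩ := F.cover b₀
  have := (contHom_iff continuous_id continuous_id).1 hf a a'
  refine (SecAt.sum (σ := fun i b => f b (E.s a i b)) hc fun i => ?_).congr ?_
  · obtain ⟨d, hd, h⟩ := this i b₀ ha ha'
    exact ⟨a', ha', d, hd, h⟩
  · filter_upwards [h] with b hb
    simp [hb]

lemma mor_of_secAt {f : ∀ b, E.E b →ₗ[ℂ] F.E b}
    (h : ∀ b₀ (σ : ∀ b, E.E b), E.SecAt σ b₀ → F.SecAt (fun b => f b (σ b)) b₀) : Mor E F f :=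
  (contHom_iff continuous_id continuous_id).2 fun _ _ i b₀ hb hb' =>
    (h b₀ _ (E.secAt_frame hb i)).coef hb'

lemma mor_of_frames {f : ∀ b, E.E b →ₗ[ℂ] F.E b}
    (h : ∀ b₀, ∃ a, b₀ ∈ E.U a ∧ ∀ i, F.SecAt (fun b => f b (E.s a i b)) b₀) : Mor E F f := by
  refine mor_of_secAt fun b₀ σ hσ => ?_
  obtain ⟨a, ha, h⟩ := h b₀
  obtain ⟨c, hc, h'⟩ := hσ.coef ha
  refine (SecAt.sum hc h).congr ?_
  filter_upwards [h'] with b hb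
  simp [hb]

lemma Mor.comp {f : ∀ b, E.E b →ₗ[ℂ] F.E b} {g : ∀ b, F.E b →ₗ[ℂ] G.E b} (hg : Mor F G g)
    (hf : Mor E F f) : Mor E G (fun b => (g b).comp (f b)) :=
  mor_of_secAt fun _ _ h => hg.secAt (hf.secAt h)

lemma Mor.pullback {f : ∀ b, E.E b →ₗ[ℂ] F.E b} (hf : Mor E F f) (g : B' → B)
    (hg : Continuous g) : Mor (E.pullback g hg) (F.pullback g hg) fun b => f (g b) := by
  intro a a' i
  obtain ⟨c, hc, h⟩ := hf a.down a'.down i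
  exact ⟨fun j b => c j (g b), fun j => (hc j).comp hg.continuousOn fun b hb => hb,
    fun b hb hb' => h (g b) hb hb'⟩

/-- The inverse of a bijective morphism of vector bundles is continuous. -/
lemma Mor.symm {f : ∀ b, E.E b ≃ₗ[ℂ] F.E b} (hf : Mor E F fun b => (f b).toLinearMap) :
    Mor F E fun b => (f b).symm.toLinearMap := by
  classical
  refine (contHom_iff continuous_id continuous_id).2 fun a' a j b₀ ha' ha => ?_
  choose c hc hc' using fun i =>
    (contHom_iff continuous_id continuous_id).1 hf a a' i b₀ ha ha'
  have hev : ∀ᶠ b in 𝓝 b₀, b ∈ E.U a ∧ b ∈ F.U a' ∧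
      ∀ i, f b (E.s a i b) = ∑ j, c i j b • F.s a' j b :=
    (E.eventually_mem_U ha).and ((F.eventually_mem_U ha').and (eventually_all.2 hc'))
  let d : E.ι a → B → ℂ := fun i b =>
    if hb : b ∈ E.U a then (E.basis a _ hb).repr ((f b).symm (F.s a' j b)) i else 0
  have hd : ∀ b, b ∈ E.U a → (f b).symm (F.s a' j b) = ∑ i, d i b • E.s a i b := by
    intro b hb
    simp only [d, dif_pos hb]
    exact ((E.basis a _ hb).sum_repr ((f b).symm (F.s a' j b))).symm.trans
      (Finset.sum_congr rfl fun _ _ => by rw [basis_apply])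
  refine ⟨d, fun i => ?_, ?_⟩
  · let e := Fintype.equivFin (E.ι a)
    have key := continuousAt_coef (x₀ := b₀) (S := fun _ => (Pi.single j 1 : F.ι a' → ℂ))
      (S' := fun i b l => c (e.symm i) l b) (c := fun i b => d (e.symm i) b) continuousAt_const
      (fun i => continuousAt_pi.2 fun l => hc _ _) ?_ ?_ (e i)
    · simpa using key
    · filter_upwards [hev] with b hb
      have h1 : F.s a' j b = ∑ l, (∑ i, d i b * c i l b) • F.s a' l b := by
        have := congrArg (f b) (hd b hb.1)
        rw [LinearEquiv.apply_symm_apply] at this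
        rw [this, map_sum]
        simp only [map_smul, hb.2.2, Finset.smul_sum, smul_smul, Finset.sum_smul]
        exact Finset.sum_comm
      have h2 : (Pi.single j 1 : F.ι a' → ℂ) = fun l => ∑ i, d i b * c i l b := by
        apply linearIndependent_iff_injective_fintypeLinearCombination.1 (F.indep a' b hb.2.1)
        rw [Fintype.linearCombination_apply_single, one_smul, Fintype.linearCombination_apply]
        exact h1
      rw [h2]
      funext l
      simp only [Finset.sum_apply, Pi.smul_apply, smul_eq_mul]
      exact (Equiv.sum_comp e.symm fun i => d i b * c i l b).symm
    · refine LinearIndependent.of_comp (Fintype.linearCombination ℂ fun l => F.s a' l b₀) ?_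
      have h3 : (⇑(Fintype.linearCombination ℂ fun l => F.s a' l b₀) ∘
          fun i l => c (e.symm i) l b₀) = fun i => f b₀ (E.s a (e.symm i) b₀) := by
        funext i
        simp [Fintype.linearCombination_apply, hev.self_of_nhds.2.2]
      rw [h3]
      have := ((E.indep a b₀ ha).map' (f b₀).toLinearMap (LinearEquiv.ker _)).comp e.symm
        e.symm.injective
      exact this
  · filter_upwards [hev] with b hb
    exact hd b hb.1

lemma Mor.iso {f : ∀ b, E.E b ≃ₗ[ℂ] F.E b} (hf : Mor E F fun b => (f b).toLinearMap) : E.Iso F :=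
  ⟨f, hf, hf.symm⟩

lemma Mor.iso_of_bijective {f : ∀ b, E.E b →ₗ[ℂ] F.E b} (hf : Mor E F f)
    (h : ∀ b, Function.Bijective (f b)) : E.Iso F :=
  Mor.iso (f := fun b => LinearEquiv.ofBijective (f b) (h b)) hf

/-! ### Sums, tensor products and classes in `K` -/

lemma prodMk_sum_smul {X Y κ κ' : Type*} [AddCommGroup X] [Module ℂ X] [AddCommGroup Y] [Module ℂ Y]
    [Fintype κ] [Fintype κ'] (c : κ → ℂ) (d : κ' → ℂ) (x : κ → X) (y : κ' → Y) :
    ((∑ j, c j • x j, ∑ j, d j • y j) : X × Y) =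
      ∑ j, Sum.elim c d j • Sum.elim (fun i => (x i, (0 : Y))) (fun i => ((0 : X), y i)) j := by
  simp [Prod.ext_iff, Prod.fst_sum, Prod.snd_sum]

lemma secAt_sum {σ : ∀ b, E.E b} {τ : ∀ b, F.E b} {b₀ : B} (hσ : E.SecAt σ b₀)
    (hτ : F.SecAt τ b₀) : (E.sum F).SecAt (fun b => (σ b, τ b)) b₀ := by
  obtain ⟨a, ha, c, hc, h⟩ := hσ
  obtain ⟨a', ha', d, hd, h'⟩ := hτ
  refine ⟨(a, a'), ⟨ha, ha'⟩, fun j b => Sum.elim (fun i => c i b) (fun i => d i b) j,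
    by rintro (j | j); exacts [hc j, hd j], ?_⟩
  filter_upwards [h, h'] with b h1 h2
  rw [h1, h2]
  exact prodMk_sum_smul _ _ _ _

lemma Mor.prod {f : ∀ b, G.E b →ₗ[ℂ] E.E b} {g : ∀ b, G.E b →ₗ[ℂ] F.E b} (hf : Mor G E f)
    (hg : Mor G F g) : Mor G (E.sum F) fun b => (f b).prod (g b) :=
  mor_of_secAt fun _ _ h => secAt_sum (hf.secAt h) (hg.secAt h)

lemma secAt_tensor {σ : ∀ b, E.E b} {τ : ∀ b, F.E b} {b₀ : B} (hσ : E.SecAt σ b₀)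
    (hτ : F.SecAt τ b₀) : (E.tensor F).SecAt (fun b => σ b ⊗ₜ[ℂ] τ b) b₀ := by
  obtain ⟨a, ha, c, hc, h⟩ := hσ
  obtain ⟨a', ha', d, hd, h'⟩ := hτ
  refine ⟨(a, a'), ⟨ha, ha'⟩, fun j b => c j.1 b * d j.2 b, fun j => (hc j.1).mul (hd j.2), ?_⟩
  filter_upwards [h, h'] with b h1 h2
  rw [h1, h2, TensorProduct.sum_tmul]
  refine Eq.trans ?_ (Fintype.sum_prod_type _).symm
  simp_rw [TensorProduct.tmul_sum, TensorProduct.smul_tmul_smul]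
  rfl

lemma Mor.tensor {E' F' : VB B} {f : ∀ b, E.E b →ₗ[ℂ] E'.E b} {g : ∀ b, F.E b →ₗ[ℂ] F'.E b}
    (hf : Mor E E' f) (hg : Mor F F' g) :
    Mor (E.tensor F) (E'.tensor F') fun b => TensorProduct.map (f b) (g b) := by
  refine mor_of_frames fun b₀ => ?_
  obtain ⟨a, ha⟩ := E.cover b₀
  obtain ⟨a', ha'⟩ := F.cover b₀
  exact ⟨(a, a'), ⟨ha, ha'⟩, fun i =>
    secAt_tensor (hf.secAt (E.secAt_frame ha i.1)) (hg.secAt (F.secAt_frame ha' i.2))⟩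

lemma cls_eq_of_iso (h : E.Iso F) : E.cls = F.cls :=
  Ideal.Quotient.eq.2 (Ideal.subset_span (KRel.iso E F h))

lemma cls_sum (E F : VB B) : (E.sum F).cls = E.cls + F.cls :=
  Ideal.Quotient.eq.2 (Ideal.subset_span (KRel.sum E F))

lemma cls_tensor (E F : VB B) : (E.tensor F).cls = E.cls * F.cls :=
  Ideal.Quotient.eq.2 (Ideal.subset_span (KRel.tensor E F))

lemma cls_one : (VB.one B).cls = 1 :=
  Ideal.Quotient.eq.2 (Ideal.subset_span KRel.one)

lemma cls_eq_zero (E : VB B) (h : ∀ b, Subsingleton (E.E b)) : E.cls = 0 := by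
  have : (E.sum E).Iso E := by
    refine Mor.iso_of_bijective (f := fun b => 0) (mor_of_frames fun b₀ => ?_) fun b => ?_
    · obtain ⟨a, ha⟩ := (E.sum E).cover b₀
      obtain ⟨a', ha'⟩ := E.cover b₀
      exact ⟨a, ha, fun i => ⟨a', ha', fun _ _ => 0, fun _ => continuousAt_const,
        .of_forall fun b => (h b).elim _ _⟩⟩
    · have := h b
      have : Subsingleton ((E.sum E).E b) := inferInstanceAs (Subsingleton (E.E b × E.E b))
      exact ⟨fun _ _ _ => Subsingleton.elim _ _, fun y => ⟨0, Subsingleton.elim _ _⟩⟩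
  have h2 := cls_eq_of_iso this
  rwa [cls_sum, add_eq_left] at h2

end VB

section Transfer

variable {C D : Type} [Groupoid.{0} C] [Groupoid.{0} D] {M : Type u} [TopologicalSpace M]

/-- The action of an arrow of `C` on the fibres over `x` of a bundle on `C × M`. -/
def GVB.actAt (W : GVB (times C M)) {c d : C} (γ : c ⟶ d) (x : M) :
    (W.bdl c).E x →ₗ[ℂ] (W.bdl d).E x :=
  W.act γ (b := x) (b' := x) rfl

lemma GVB.actAt_comp (W : GVB (times C M)) {c d e : C} (γ : c ⟶ d) (δ : d ⟶ e) {x : M}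
    (v : (W.bdl c).E x) : W.actAt (γ ≫ δ) x v = W.actAt δ x (W.actAt γ x v) :=
  W.act_comp γ δ (b := x) (b' := x) (b'' := x) rfl rfl rfl v

lemma limFibre_actAt {W : GVB (times C M)} {P : C → Prop} {x : M} (v : limFibre W P x)
    {c d : {c // P c}} (γ : c.1 ⟶ d.1) : W.actAt γ x (v.1 c) = v.1 d :=
  v.2 c d γ

/-- The component at `c` of the elements of the limit. -/
def limProj (W : GVB (times C M)) (P : C → Prop) (c : {c // P c}) (x : M) :
    limFibre W P x →ₗ[ℂ] (W.bdl c.1).E x :=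
  (LinearMap.proj c).comp (limFibre W P x).subtype

variable [∀ c d : C, Finite (c ⟶ d)] [∀ c d : D, Finite (c ⟶ d)]

/-- A section of the transfer is continuous if and only if its components are. -/
lemma secAt_transfer {W : GVB (times C M)} {P : C → Prop} [Finite {c // P c}]
    {σ : ∀ x, (transfer W P).E x} {x₀ : M} :
    (transfer W P).SecAt σ x₀ ↔
      ∀ c : {c // P c}, (W.bdl c.1).SecAt (fun x => (show limFibre W P x from σ x).1 c) x₀ := by
  constructor
  · rintro ⟨φ, hφ, k, hk, h⟩ c
    have h1 : ∀ j, (W.bdl c.1).SecAt (fun x => (φ.s j x).1 c) x₀ := by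
      intro j
      obtain ⟨a, ha⟩ := (W.bdl c.1).cover x₀
      obtain ⟨l, hl, hl'⟩ := φ.cont j c a
      have hn := (φ.isOpen.inter ((W.bdl c.1).isOpen a)).mem_nhds ⟨hφ, ha⟩
      exact ⟨a, ha, l, fun i => (hl i).continuousAt hn, by filter_upwards [hn] using hl'⟩
    refine (VB.SecAt.sum hk h1).congr ?_
    filter_upwards [h] with x hx
    have h2 : (show limFibre W P x from σ x) = ∑ j, k j x • φ.s j x := hx
    change (show limFibre W P x from σ x).1 c = _
    rw [h2]
    simp [Finset.sum_apply]
  · intro h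
    obtain ⟨φ, hφ⟩ := LimFrame.exists_frame W P x₀
    choose a ha using fun c : {c // P c} => (W.bdl c.1).cover x₀
    choose k hk hk' using fun c => (h c).coef (ha c)
    choose S' hS' using fun j => φ.exists_coord a j
    have hspan : ∀ x, ∃ c : Fin φ.n → ℂ, x ∈ φ.U →
        (show limFibre W P x from σ x) = ∑ j, c j • φ.s j x := by
      intro x
      by_cases hx : x ∈ φ.U
      · obtain ⟨c, hc⟩ := (Submodule.mem_span_range_iff_exists_fun ℂ).1
          (φ.spans x hx (Submodule.mem_top (x := σ x)))
        exact ⟨c, fun _ => hc.symm⟩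
      · exact ⟨0, fun h => absurd h hx⟩
    choose c hc using hspan
    have hnear : ∀ᶠ x in 𝓝 x₀, x ∈ φ.U ∧ (∀ d : {c // P c}, x ∈ (W.bdl d.1).U (a d)) ∧
        ∀ d, (show limFibre W P x from σ x).1 d = ∑ j, k d j x • (W.bdl d.1).s (a d) j x :=
      Filter.Eventually.and (φ.isOpen.mem_nhds hφ) (Filter.Eventually.and
        (eventually_all.2 fun d => ((W.bdl d.1).isOpen (a d)).mem_nhds (ha d))
        (eventually_all.2 hk'))
    refine ⟨φ, hφ, fun j x => c x j, fun j => ?_, ?_⟩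
    · refine continuousAt_coef (S := fun x q => k q.1 q.2 x) (S' := S') (c := fun j x => c x j)
        (continuousAt_pi.2 fun q => hk _ _) (fun j => (hS' j x₀ hφ ha).1) ?_ ?_ j
      · filter_upwards [hnear] with x hx
        apply comb_injective W P a x hx.2.1
        rw [map_sum]
        simp only [map_smul, ← (hS' _ x hx.1 hx.2.1).2]
        trans (show limFibre W P x from σ x).1
        · funext d
          exact (hx.2.2 d).symm
        · rw [hc x hx.1]
          simp
      · refine LinearIndependent.of_comp (comb W P a x₀) ?_
        have h3 : (⇑(comb W P a x₀) ∘ fun j => S' j x₀) =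
            ⇑(limFibre W P x₀).subtype ∘ fun i => φ.s i x₀ :=
          funext fun j => ((hS' j x₀ hφ ha).2).symm
        rw [h3]
        exact (φ.indep x₀ hφ).map' (limFibre W P x₀).subtype (Submodule.ker_subtype _)
    · filter_upwards [hnear] with x hx
      exact hc x hx.1

lemma limProj_mor (W : GVB (times C M)) (P : C → Prop) [Finite {c // P c}] (c : {c // P c}) :
    VB.Mor (transfer W P) (W.bdl c.1) (limProj W P c) :=
  VB.mor_of_secAt fun _ _ h => secAt_transfer.1 h c

lemma mor_transfer {W : GVB (times C M)} {P : C → Prop} [Finite {c // P c}] {E : VB M}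
    {f : ∀ x, E.E x →ₗ[ℂ] limFibre W P x}
    (h : ∀ c, VB.Mor E (W.bdl c.1) fun x => (limProj W P c x).comp (f x)) :
    VB.Mor E (transfer W P) f :=
  VB.mor_of_secAt fun _ _ hσ => secAt_transfer.2 fun c => (h c).secAt hσ

/-- Comparison of transfers: it suffices to compare the fibres at a set of objects that meets all
isomorphism classes, together with the linear maps that are induced by arrows. -/
lemma transfer_iso {W : GVB (times C M)} {P : C → Prop} {W' : GVB (times D M)} {P' : D → Prop}
    [Finite {c // P c}] [Finite {d // P' d}] (F : {d // P' d} → {c // P c})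
    (φ : ∀ d x, (W.bdl (F d).1).E x ≃ₗ[ℂ] (W'.bdl d.1).E x)
    (hφ : ∀ d, VB.Mor (W.bdl (F d).1) (W'.bdl d.1) fun x => (φ d x).toLinearMap)
    (h1 : ∀ d d' (δ : d.1 ⟶ d'.1), ∃ γ : (F d).1 ⟶ (F d').1, ∀ x v,
      φ d' x (W.actAt γ x v) = W'.actAt δ x (φ d x v))
    (h2 : ∀ d d' (γ : (F d).1 ⟶ (F d').1), ∃ δ : d.1 ⟶ d'.1, ∀ x v,
      φ d' x (W.actAt γ x v) = W'.actAt δ x (φ d x v))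
    (h3 : ∀ c : {c // P c}, ∃ d, Nonempty ((F d).1 ⟶ c.1)) :
    (transfer W P).Iso (transfer W' P') := by
  let L : ∀ x, limFibre W P x →ₗ[ℂ] limFibre W' P' x := fun x =>
    LinearMap.codRestrict _
      (LinearMap.pi fun d => (φ d x).toLinearMap.comp (limProj W P (F d) x)) fun v d d' δ => by
        obtain ⟨γ, hγ⟩ := h1 d d' δ
        exact (hγ x (v.1 (F d))).symm.trans (congrArg (φ d' x) (limFibre_actAt v γ))
  have hL : ∀ x v d, (L x v).1 d = φ d x (v.1 (F d)) := fun _ _ _ => rfl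
  refine VB.Mor.iso_of_bijective (f := L)
    (mor_transfer fun d => VB.Mor.comp (hφ d) (limProj_mor W P (F d))) fun x => ⟨?_, fun (w : limFibre W' P' x) => ?_⟩
  · refine (injective_iff_map_eq_zero (L x)).2 fun v hv => Subtype.ext (funext fun c => ?_)
    obtain ⟨d, ⟨γ⟩⟩ := h3 c
    have h : v.1 (F d) = 0 := (φ d x).injective (by
      rw [← hL, hv, map_zero]; rfl)
    rw [← limFibre_actAt v (c := F d) γ, h, map_zero]
    rfl
  · choose d hd using h3
    let γ := fun c => (hd c).some
    have key : ∀ d d' (ζ : (F d).1 ⟶ (F d').1),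
        W.actAt ζ x ((φ d x).symm (w.1 d)) = (φ d' x).symm (w.1 d') := by
      intro d d' ζ
      obtain ⟨δ, hδ⟩ := h2 d d' ζ
      rw [LinearEquiv.eq_symm_apply, hδ, LinearEquiv.apply_symm_apply, limFibre_actAt w δ]
    refine ⟨⟨fun c => W.actAt (γ c) x ((φ (d c) x).symm (w.1 (d c))), fun c e η => ?_⟩,
      Subtype.ext (funext fun e => ?_)⟩
    · change W.actAt η x (W.actAt (γ c) x ((φ (d c) x).symm (w.1 (d c)))) =
        W.actAt (γ e) x ((φ (d e) x).symm (w.1 (d e)))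
      rw [← W.actAt_comp, ← key _ _ (γ c ≫ η ≫ Groupoid.inv (γ e)), ← W.actAt_comp]
      simp
    · exact (LinearEquiv.eq_symm_apply _).1 (key _ e (γ (F e)))

instance finite_subtype_and {α : Type*} (Q P : α → Prop) [Finite {c // P c}] :
    Finite {c // Q c ∧ P c} :=
  Finite.of_injective (fun c => (⟨c.1, c.2.2⟩ : {c // P c})) fun _ _ h =>
    Subtype.ext (congrArg (fun c : {c // P c} => c.1) h)

/-- The restriction of the elements of the limit to fewer objects. -/
def limRestrict (W : GVB (times C M)) {P Q : C → Prop} (h : ∀ c, P c → Q c) (x : M) :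
    limFibre W Q x →ₗ[ℂ] limFibre W P x :=
  LinearMap.codRestrict _ (LinearMap.pi fun c => limProj W Q ⟨c.1, h c.1 c.2⟩ x)
    fun v c d γ => v.2 ⟨c.1, h c.1 c.2⟩ ⟨d.1, h d.1 d.2⟩ γ

lemma limRestrict_mor (W : GVB (times C M)) {P Q : C → Prop} [Finite {c // P c}]
    [Finite {c // Q c}] (h : ∀ c, P c → Q c) :
    VB.Mor (transfer W Q) (transfer W P) (limRestrict W h) :=
  mor_transfer fun c => limProj_mor W Q ⟨c.1, h c.1 c.2⟩

/-- The transfer is additive for disjoint unions of groupoids. -/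
lemma cls_transfer_or (W : GVB (times C M)) {P Q R : C → Prop} [Finite {c // P c}]
    [Finite {c // Q c}] [Finite {c // R c}] (h : ∀ c, R c ↔ P c ∨ Q c)
    (hPQ : ∀ c d, P c → Q d → IsEmpty (c ⟶ d)) :
    (transfer W R).cls = (transfer W P).cls + (transfer W Q).cls := by
  classical
  have hP : ∀ c, P c → R c := fun c hc => (h c).2 (.inl hc)
  have hQ : ∀ c, Q c → R c := fun c hc => (h c).2 (.inr hc)
  rw [← VB.cls_sum]
  refine VB.cls_eq_of_iso (VB.Mor.iso_of_bijective
    ((limRestrict_mor W hP).prod (limRestrict_mor W hQ)) fun x => ⟨?_, ?_⟩)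
  · intro v w hvw
    obtain ⟨h1, h2⟩ := Prod.ext_iff.1 hvw
    refine Subtype.ext (funext fun c => ?_)
    rcases (h c.1).1 c.2 with hc | hc
    · exact congrFun (congrArg Subtype.val h1) ⟨c.1, hc⟩
    · exact congrFun (congrArg Subtype.val h2) ⟨c.1, hc⟩
  · rintro ⟨v, w⟩
    have hdis : ∀ c, P c → ¬ Q c := fun c hp hq => (hPQ c c hp hq).false (𝟙 c)
    have hQ' : ∀ c : {c // R c}, ¬ P c.1 → Q c.1 := fun c hc => ((h c.1).1 c.2).resolve_left hc
    let v' : limFibre W P x := v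
    let w' : limFibre W Q x := w
    refine ⟨⟨fun c => if hc : P c.1 then v'.1 ⟨c.1, hc⟩ else w'.1 ⟨c.1, hQ' c hc⟩, ?_⟩, ?_⟩
    · intro c d γ
      by_cases hc : P c.1 <;> by_cases hd : P d.1
      · simp only [dif_pos hc, dif_pos hd]
        exact v'.2 ⟨c.1, hc⟩ ⟨d.1, hd⟩ γ
      · exact ((hPQ _ _ hc (hQ' d hd)).false γ).elim
      · exact ((hPQ _ _ hd (hQ' c hc)).false (Groupoid.inv γ)).elim
      · simp only [dif_neg hc, dif_neg hd]
        exact w'.2 ⟨c.1, hQ' c hc⟩ ⟨d.1, hQ' d hd⟩ γ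
    · refine Prod.ext (Subtype.ext (funext fun c => ?_)) (Subtype.ext (funext fun c => ?_))
      · exact dif_pos c.2
      · exact dif_neg fun hc => hdis _ hc c.2

lemma cls_transfer_eq_zero (W : GVB (times C M)) {P : C → Prop} [Finite {c // P c}]
    (h : ∀ c, ¬ P c) : (transfer W P).cls = 0 :=
  VB.cls_eq_zero _ fun _ => ⟨fun _ _ => Subtype.ext (funext fun c => (h c.1 c.2).elim)⟩

lemma cls_transfer_fiberwise {ι : Type*} (W : GVB (times C M)) (P : C → Prop) [Finite {c // P c}]
    (f : C → ι) (hf : ∀ c d, (c ⟶ d) → f c = f d) (s : Finset ι) :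
    (transfer W fun c => f c ∈ s ∧ P c).cls = ∑ i ∈ s, (transfer W fun c => f c = i ∧ P c).cls := by
  classical
  induction s using Finset.induction_on with
  | empty => exact cls_transfer_eq_zero W fun c hc => by simpa using hc.1
  | insert i s hi ih =>
    rw [Finset.sum_insert hi, ← ih]
    refine cls_transfer_or W (fun c => ?_) fun c d hc hd => ⟨fun γ => hi ?_⟩
    · rw [Finset.mem_insert, or_and_right]
    · rw [← hc.1, hf c d γ]; exact hd.1

/-! ### External tensor products -/

/-- The external tensor product of bundles on `C × M` and `D × M`. -/
def GVB.box (W : GVB (times C M)) (W' : GVB (times D M)) : GVB (times (C × D) M) where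
  bdl c := (W.bdl c.1).tensor (W'.bdl c.2)
  act {c d} γ {b b'} h := TensorProduct.map (W.act γ.1 (b := b) (b' := b') h)
    (W'.act γ.2 (b := b) (b' := b') h)
  act_cont {c d} γ a a' i := by
    obtain ⟨k, hk, h⟩ := W.act_cont γ.1 a.1 a'.1 i.1
    obtain ⟨l, hl, h'⟩ := W'.act_cont γ.2 a.2 a'.2 i.2
    refine ⟨fun j q => k j.1 q * l j.2 q, fun j => ?_, fun q hq hq' => ?_⟩
    · exact ((hk j.1).mono fun q hq => ⟨hq.1.1, hq.2.1⟩).mul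
        ((hl j.2).mono fun q hq => ⟨hq.1.2, hq.2.2⟩)
    · have e1 := h q hq.1 hq'.1
      have e2 := h' q hq.2 hq'.2
      refine (TensorProduct.map_tmul _ _ _ _).trans ?_
      refine (congrArg₂ (fun x y => x ⊗ₜ[ℂ] y) e1 e2).trans ?_
      rw [TensorProduct.sum_tmul]
      refine Eq.trans ?_ (Fintype.sum_prod_type _).symm
      simp_rw [TensorProduct.tmul_sum, TensorProduct.smul_tmul_smul]
      rfl
  act_id {c b} h v := by
    refine LinearMap.congr_fun (f := TensorProduct.map (W.act (𝟙 c.1) (b := b) (b' := b) h)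
      (W'.act (𝟙 c.2) (b := b) (b' := b) h)) (g := LinearMap.id) ?_ v
    refine TensorProduct.ext' fun v w => ?_
    rw [TensorProduct.map_tmul, W.act_id h, W'.act_id h]
    rfl
  act_comp {c d e} γ δ b b' b'' h h' h'' v := by
    refine LinearMap.congr_fun (f := TensorProduct.map (W.act (γ.1 ≫ δ.1) (b := b) (b' := b'') h'')
      (W'.act (γ.2 ≫ δ.2) (b := b) (b' := b'') h'')) (g := (TensorProduct.map
        (W.act δ.1 (b := b') (b' := b'') h') (W'.act δ.2 (b := b') (b' := b'') h')).comp
      (TensorProduct.map (W.act γ.1 (b := b) (b' := b') h)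
        (W'.act γ.2 (b := b) (b' := b') h))) ?_ v
    refine TensorProduct.ext' fun v w => ?_
    rw [LinearMap.comp_apply, TensorProduct.map_tmul, TensorProduct.map_tmul,
      TensorProduct.map_tmul, W.act_comp γ.1 δ.1 h h' h'', W'.act_comp γ.2 δ.2 h h' h'']

/-- The average, as a linear map to the limit. -/
def avgLim (W : GVB (times C M)) (P : C → Prop) [Finite {c // P c}] (x : M) :
    (∀ c : {c // P c}, (W.bdl c.1).E x) →ₗ[ℂ] limFibre W P x :=
  (avg W P x).codRestrict _ (avg_isProj W P x).map_mem

lemma avgLim_coe (W : GVB (times C M)) (P : C → Prop) [Finite {c // P c}] (x : M)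
    (v : limFibre W P x) : avgLim W P x v.1 = v :=
  Subtype.ext ((avg_isProj W P x).map_id _ v.2)

lemma avg_single [DecidableEq C] (W : GVB (times C M)) (P : C → Prop) [Finite {c // P c}]
    (x : M) (c d : {c // P c}) :
    letI := Fintype.ofFinite {c // P c}
    letI := fun c d : C => Fintype.ofFinite (c ⟶ d)
    ((limProj W P d x).comp (avgLim W P x)).comp (LinearMap.single ℂ _ c) =
      (∑ c : {c // P c}, (Fintype.card (c.1 ⟶ d.1) : ℂ))⁻¹ • ∑ γ : c.1 ⟶ d.1, W.actAt γ x := by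
  let := Fintype.ofFinite {c // P c}
  let := fun c d : C => Fintype.ofFinite (c ⟶ d)
  refine LinearMap.ext fun u => ?_
  change avg W P x (Pi.single c u) d = _
  simp only [avg, LinearMap.pi_apply, LinearMap.smul_apply, LinearMap.sum_apply,
      LinearMap.comp_apply, LinearMap.proj_apply]
  congr 1
  · rw [Fintype.card_sigma, Nat.cast_sum]
  · rw [Fintype.sum_sigma, Finset.sum_eq_single c]
    · simp only [Pi.single_eq_same]
      rfl
    · intro e _ he
      simp [Pi.single_eq_of_ne he]
    · simp

/-- The comparison map from the tensor product of two limits. -/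
def limTensor (W : GVB (times C M)) (P : C → Prop) (W' : GVB (times D M)) (P' : D → Prop) (x : M) :
    limFibre W P x ⊗[ℂ] limFibre W' P' x →ₗ[ℂ]
      limFibre (W.box W') (fun c => P c.1 ∧ P' c.2) x :=
  LinearMap.codRestrict _ (LinearMap.pi fun c => TensorProduct.map
    (limProj W P ⟨c.1.1, c.2.1⟩ x) (limProj W' P' ⟨c.1.2, c.2.2⟩ x)) fun t c d γ => by
      refine LinearMap.congr_fun (f := (TensorProduct.map (W.actAt γ.1 x) (W'.actAt γ.2 x)).comp
        (TensorProduct.map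
          (limProj W P ⟨c.1.1, c.2.1⟩ x) (limProj W' P' ⟨c.1.2, c.2.2⟩ x))) (g := TensorProduct.map
        (limProj W P ⟨d.1.1, d.2.1⟩ x) (limProj W' P' ⟨d.1.2, d.2.2⟩ x)) ?_ t
      refine TensorProduct.ext' fun v w => ?_
      exact congrArg₂ (fun y z => y ⊗ₜ[ℂ] z)
        (limFibre_actAt v (c := ⟨c.1.1, c.2.1⟩) (d := ⟨d.1.1, d.2.1⟩) γ.1)
        (limFibre_actAt w (c := ⟨c.1.2, c.2.2⟩) (d := ⟨d.1.2, d.2.2⟩) γ.2)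

lemma limTensor_bijective (W : GVB (times C M)) (P : C → Prop) (W' : GVB (times D M))
    (P' : D → Prop) [Finite {c // P c}] [Finite {c // P' c}] (x : M) :
    Function.Bijective (limTensor W P W' P' x) := by
  classical
  let := Fintype.ofFinite {c // P c}
  let := fun c d : C => Fintype.ofFinite (c ⟶ d)
  let := Fintype.ofFinite {c // P' c}
  let := fun c d : D => Fintype.ofFinite (c ⟶ d)
  let G : limFibre (W.box W') (fun c => P c.1 ∧ P' c.2) x →ₗ[ℂ]
      limFibre W P x ⊗[ℂ] limFibre W' P' x :=
    ∑ c : {c // P c}, ∑ c' : {c // P' c}, (TensorProduct.map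
      ((avgLim W P x).comp (LinearMap.single ℂ _ c))
      ((avgLim W' P' x).comp (LinearMap.single ℂ _ c'))).comp
        (limProj (W.box W') (fun c => P c.1 ∧ P' c.2) ⟨(c.1, c'.1), c.2, c'.2⟩ x)
  have hG : G.comp (limTensor W P W' P' x) = LinearMap.id := by
    refine TensorProduct.ext' fun v w => ?_
    have h1 : ∑ c, Pi.single c (v.1 c) = v.1 := Finset.univ_sum_single v.1
    have h2 : ∑ c, Pi.single c (w.1 c) = w.1 := Finset.univ_sum_single w.1
    have h3 := avgLim_coe W P x v
    have h4 := avgLim_coe W' P' x w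
    rw [← h1, map_sum] at h3
    rw [← h2, map_sum] at h4
    conv_rhs => rw [LinearMap.id_apply, ← h3, ← h4, TensorProduct.sum_tmul]
    simp only [G, LinearMap.comp_apply, LinearMap.sum_apply, TensorProduct.tmul_sum]
    rfl
  refine ⟨Function.LeftInverse.injective (g := G) (LinearMap.congr_fun hG), fun w => ⟨G w, ?_⟩⟩
  refine Subtype.ext (funext fun d => ?_)
  let N : ℂ := ∑ c : {c // P c}, (Fintype.card (c.1 ⟶ d.1.1) : ℂ)
  let N' : ℂ := ∑ c : {c // P' c}, (Fintype.card (c.1 ⟶ d.1.2) : ℂ)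
  have hN : N ≠ 0 := by
    have h0 : (∑ c : {c // P c}, Fintype.card (c.1 ⟶ d.1.1)) ≠ 0 := fun h =>
      (Fintype.card_pos_iff.2 ⟨𝟙 d.1.1⟩).ne'
        (Finset.sum_eq_zero_iff.1 h ⟨d.1.1, d.2.1⟩ (Finset.mem_univ _))
    simp only [N]
    exact_mod_cast h0
  have hN' : N' ≠ 0 := by
    have h0 : (∑ c : {c // P' c}, Fintype.card (c.1 ⟶ d.1.2)) ≠ 0 := fun h =>
      (Fintype.card_pos_iff.2 ⟨𝟙 d.1.2⟩).ne'
        (Finset.sum_eq_zero_iff.1 h ⟨d.1.2, d.2.2⟩ (Finset.mem_univ _))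
    simp only [N']
    exact_mod_cast h0
  have key : ∀ (c : {c // P c}) (c' : {c // P' c}),
      TensorProduct.map
        (((limProj W P ⟨d.1.1, d.2.1⟩ x).comp (avgLim W P x)).comp (LinearMap.single ℂ _ c))
        (((limProj W' P' ⟨d.1.2, d.2.2⟩ x).comp (avgLim W' P' x)).comp
          (LinearMap.single ℂ _ c')) (w.1 ⟨(c.1, c'.1), c.2, c'.2⟩) =
      (N⁻¹ * N'⁻¹ * (Fintype.card (c.1 ⟶ d.1.1) * Fintype.card (c'.1 ⟶ d.1.2))) • w.1 d := by
    intro c c'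
    rw [avg_single W P x c ⟨d.1.1, d.2.1⟩, avg_single W' P' x c' ⟨d.1.2, d.2.2⟩]
    have h5 : ∀ (γ : c.1 ⟶ d.1.1) (γ' : c'.1 ⟶ d.1.2),
        TensorProduct.map (W.actAt γ x) (W'.actAt γ' x) (w.1 ⟨(c.1, c'.1), c.2, c'.2⟩) = w.1 d :=
      fun γ γ' => w.2 ⟨(c.1, c'.1), c.2, c'.2⟩ d (γ, γ')
    have h6 : ∀ {X X' Y Y' κ κ' : Type} [AddCommGroup X] [Module ℂ X] [AddCommGroup X']
        [Module ℂ X'] [AddCommGroup Y] [Module ℂ Y] [AddCommGroup Y'] [Module ℂ Y'] [Fintype κ]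
        [Fintype κ'] (a b : ℂ) (f : κ → X →ₗ[ℂ] Y) (g : κ' → X' →ₗ[ℂ] Y') (t : X ⊗[ℂ] X')
        (t' : Y ⊗[ℂ] Y') (_ : ∀ i j, TensorProduct.map (f i) (g j) t = t'),
        TensorProduct.map (a • ∑ i, f i) (b • ∑ j, g j) t =
          (a * b * (Fintype.card κ * Fintype.card κ')) • t' := by
      intro X X' Y Y' κ κ' _ _ _ _ _ _ _ _ _ _ a b f g t t' h
      have : TensorProduct.map (∑ i, f i) (∑ j, g j) =
          ∑ i, ∑ j, TensorProduct.map (f i) (g j) := by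
        simp only [← TensorProduct.mapBilinear_apply, map_sum, LinearMap.sum_apply]
        exact Finset.sum_comm
      rw [TensorProduct.map_smul_left, TensorProduct.map_smul_right, this]
      simp only [LinearMap.smul_apply, LinearMap.sum_apply, h, Finset.sum_const, Finset.card_univ,
        ← Nat.cast_smul_eq_nsmul ℂ, smul_smul]
    exact h6 _ _ _ _ _ _ h5
  have h7 : (limTensor W P W' P' x (G w)).1 d = ∑ c : {c // P c}, ∑ c' : {c // P' c},
      TensorProduct.map
        (((limProj W P ⟨d.1.1, d.2.1⟩ x).comp (avgLim W P x)).comp (LinearMap.single ℂ _ c))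
        (((limProj W' P' ⟨d.1.2, d.2.2⟩ x).comp (avgLim W' P' x)).comp
          (LinearMap.single ℂ _ c')) (w.1 ⟨(c.1, c'.1), c.2, c'.2⟩) := by
    change TensorProduct.map (limProj W P ⟨d.1.1, d.2.1⟩ x) (limProj W' P' ⟨d.1.2, d.2.2⟩ x)
      (G w) = _
    simp only [G, LinearMap.sum_apply, map_sum, LinearMap.comp_assoc, TensorProduct.map_comp]
    rfl
  have h8 : ∀ {X κ κ' : Type} [AddCommGroup X] [Module ℂ X] [Fintype κ] [Fintype κ'] (k : ℂ)
      (a : κ → ℂ) (b : κ' → ℂ) (t : X), ∑ i, ∑ j, (k * (a i * b j)) • t =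
        (k * ((∑ i, a i) * ∑ j, b j)) • t := by
    intro X κ κ' _ _ _ _ k a b t
    rw [Finset.sum_mul_sum]
    simp only [Finset.mul_sum, Finset.sum_smul]
  rw [h7]
  refine (Finset.sum_congr rfl fun c _ => Finset.sum_congr rfl fun c' _ => key c c').trans ?_
  refine (h8 _ _ _ _).trans ?_
  change (N⁻¹ * N'⁻¹ * (N * N')) • w.1 d = w.1 d
  rw [show N⁻¹ * N'⁻¹ * (N * N') = 1 by field_simp, one_smul]

instance finite_prod_and {P : C → Prop} {P' : D → Prop} [Finite {c // P c}]
    [Finite {c // P' c}] : Finite {c : C × D // P c.1 ∧ P' c.2} :=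
  Finite.of_injective
    (fun c => ((⟨c.1.1, c.2.1⟩, ⟨c.1.2, c.2.2⟩) : {c // P c} × {c // P' c}))
    fun c d h => by
      simp only [Prod.mk.injEq, Subtype.mk.injEq] at h
      exact Subtype.ext (Prod.ext h.1 h.2)

instance finite_prod_hom (c d : C × D) : Finite (c ⟶ d) :=
  inferInstanceAs (Finite ((c.1 ⟶ d.1) × (c.2 ⟶ d.2)))

/-- The transfer is compatible with external tensor products. -/
lemma transfer_box (W : GVB (times C M)) (P : C → Prop) (W' : GVB (times D M)) (P' : D → Prop)
    [Finite {c // P c}] [Finite {c // P' c}] :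
    ((transfer W P).tensor (transfer W' P')).Iso
      (transfer (W.box W') fun c => P c.1 ∧ P' c.2) :=
  VB.Mor.iso_of_bijective (f := limTensor W P W' P')
    (mor_transfer fun c => (limProj_mor W P ⟨c.1.1, c.2.1⟩).tensor
      (limProj_mor W' P' ⟨c.1.2, c.2.2⟩))
    (limTensor_bijective W P W' P')

end Transfer

/-! ### Bundles on topological groupoids -/

namespace GVB

variable {X Y : TGpd.{u}} {U V W : GVB X}

lemma act_congr (V : GVB X) {c d : X.Ix} {γ γ' : c ⟶ d} (e : γ = γ') {b : X.fib c} {b' : X.fib d}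
    (h : X.tr γ b = b') (h' : X.tr γ' b = b') (v : (V.bdl c).E b) : V.act γ h v = V.act γ' h' v := by
  subst e; rfl

lemma act_eq_of_eq_id (V : GVB X) {c : X.Ix} {γ : c ⟶ c} (e : γ = 𝟙 c) {b : X.fib c}
    (h : X.tr γ b = b) (v : (V.bdl c).E b) : V.act γ h v = v := by
  subst e; exact V.act_id h v

lemma act_bijective (V : GVB X) {c d : X.Ix} (γ : c ⟶ d) {b : X.fib c} {b' : X.fib d}
    (h : X.tr γ b = b') : Function.Bijective (V.act γ h) := by
  have h' : X.tr (Groupoid.inv γ) b' = b := by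
    rw [← h, ← X.tr_comp, Groupoid.comp_inv, X.tr_id]
  refine Function.bijective_iff_has_inverse.2 ⟨V.act (Groupoid.inv γ) h', fun v => ?_, fun v => ?_⟩
  · rw [← V.act_comp γ (Groupoid.inv γ) h h' (by rw [Groupoid.comp_inv, X.tr_id])]
    exact V.act_eq_of_eq_id (Groupoid.comp_inv γ) _ v
  · rw [← V.act_comp (Groupoid.inv γ) γ h' h (by rw [Groupoid.inv_comp, X.tr_id])]
    exact V.act_eq_of_eq_id (Groupoid.inv_comp γ) _ v

lemma iso_of_bijective (f : ∀ c b, (V.bdl c).E b →ₗ[ℂ] (W.bdl c).E b)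
    (hb : ∀ c b, Function.Bijective (f c b)) (hf : ∀ c, VB.Mor (V.bdl c) (W.bdl c) (f c))
    (h : ∀ {c d : X.Ix} (γ : c ⟶ d) {b : X.fib c} {b' : X.fib d} (h : X.tr γ b = b')
      (v : (V.bdl c).E b), f d b' (V.act γ h v) = W.act γ h (f c b v)) : V.Iso W := by
  let e : ∀ c b, (V.bdl c).E b ≃ₗ[ℂ] (W.bdl c).E b := fun c b => .ofBijective (f c b) (hb c b)
  have he : ∀ c, VB.Mor (V.bdl c) (W.bdl c) fun b => (e c b).toLinearMap := hf
  exact ⟨e, he, fun c => (he c).symm, h⟩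

lemma Iso.symm (h : V.Iso W) : W.Iso V := by
  obtain ⟨f, hf, hf', h⟩ := h
  refine ⟨fun c b => (f c b).symm, hf', hf, fun {c d} γ b b' hb w => ?_⟩
  rw [LinearEquiv.symm_apply_eq, h, LinearEquiv.apply_symm_apply]

lemma Iso.trans (h : U.Iso V) (h' : V.Iso W) : U.Iso W := by
  obtain ⟨f, hf, -, h⟩ := h
  obtain ⟨g, hg, -, h'⟩ := h'
  refine iso_of_bijective (fun c b => ((f c b).trans (g c b)).toLinearMap)
    (fun c b => ((f c b).trans (g c b)).bijective) (fun c => VB.Mor.comp (hg c) (hf c)) ?_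
  intro c d γ b b' hb v
  exact (congrArg (g d b') (h γ hb v)).trans (h' γ hb _)

lemma Iso.pullback {V W : GVB Y} (h : V.Iso W) (F : TFun X Y) :
    (V.pullback F).Iso (W.pullback F) := by
  obtain ⟨f, hf, hf', h⟩ := h
  exact ⟨fun c b => f _ (F.map c b), fun c => VB.Mor.pullback (hf _) _ (F.map_cont c),
    fun c => VB.Mor.pullback (hf' _) _ (F.map_cont c), fun γ b b' hb v => h _ _ v⟩

end GVB

section Equivalence

variable {X Y : TGpd.{u}} (Q : TFun X Y) [Q.ix.IsEquivalence]
  {g : ∀ c, Y.fib (Q.ix.obj c) → X.fib c} (hg : ∀ c, Continuous (g c))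
  (h₁ : ∀ c b, g c (Q.map c b) = b) (h₂ : ∀ c y, Q.map c (g c y) = y)

/-- The counit of the equivalence on objects. -/
def TFun.counit (d : Y.Ix) : Q.ix.obj (Q.ix.inv.obj d) ⟶ d :=
  Q.ix.asEquivalence.counit.app d

/-- The inverse of the counit of the equivalence on objects. -/
def TFun.counitInv (d : Y.Ix) : d ⟶ Q.ix.obj (Q.ix.inv.obj d) :=
  Q.ix.asEquivalence.counitInv.app d

/-- The unit of the equivalence on objects. -/
def TFun.unit (c : X.Ix) : c ⟶ Q.ix.inv.obj (Q.ix.obj c) :=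
  Q.ix.asEquivalence.unit.app c

/-- The inverse of the unit of the equivalence on objects. -/
def TFun.unitInv (c : X.Ix) : Q.ix.inv.obj (Q.ix.obj c) ⟶ c :=
  Q.ix.asEquivalence.unitInv.app c

lemma TFun.counitInv_counit (d : Y.Ix) : Q.counitInv d ≫ Q.counit d = 𝟙 d :=
  Q.ix.asEquivalence.counitIso.inv_hom_id_app d

lemma TFun.unit_unitInv (c : X.Ix) : Q.unit c ≫ Q.unitInv c = 𝟙 c :=
  Q.ix.asEquivalence.unitIso.hom_inv_id_app c

lemma TFun.counitInv_obj (c : X.Ix) : Q.counitInv (Q.ix.obj c) = Q.ix.map (Q.unit c) :=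
  Q.ix.asEquivalence.counitInv_app_functor c

lemma TFun.counitInv_naturality {c d : Y.Ix} (γ : c ⟶ d) :
    γ ≫ Q.counitInv d = Q.counitInv c ≫ Q.ix.map (Q.ix.inv.map γ) :=
  Q.ix.asEquivalence.counitInv.naturality γ

lemma TFun.counit_naturality {c d : Y.Ix} (γ : c ⟶ d) :
    Q.ix.map (Q.ix.inv.map γ) ≫ Q.counit d = Q.counit c ≫ γ :=
  Q.ix.asEquivalence.counit.naturality γ

lemma TFun.unitInv_naturality {c d : X.Ix} (γ : c ⟶ d) :
    Q.ix.inv.map (Q.ix.map γ) ≫ Q.unitInv d = Q.unitInv c ≫ γ :=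
  Q.ix.asEquivalence.unitInv.naturality γ

/-- The inverse of an equivalence of topological groupoids. -/
abbrev TFun.inverse : TFun Y X where
  ix := Q.ix.inv
  map d y := g _ (Y.tr (Q.counitInv d) y)
  map_cont d := (hg _).comp (Y.tr_cont _)
  map_tr {c d} γ y := by
    rw [← h₁ _ (X.tr _ _), ← Q.map_tr, h₂, ← Y.tr_comp, ← Y.tr_comp, Q.counitInv_naturality]

lemma TFun.tr_unitInv (c : X.Ix) (b : X.fib c) :
    X.tr (Q.unitInv c) ((Q.inverse hg h₁ h₂).map _ (Q.map c b)) = b := by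
  change X.tr (Q.unitInv c) (g _ (Y.tr (Q.counitInv (Q.ix.obj c)) (Q.map c b))) = b
  rw [Q.counitInv_obj, Q.map_tr, h₁, ← X.tr_comp, Q.unit_unitInv, X.tr_id]

lemma TFun.tr_counit (d : Y.Ix) (y : Y.fib d) :
    Y.tr (Q.counit d) (Q.map _ ((Q.inverse hg h₁ h₂).map d y)) = y := by
  rw [h₂, ← Y.tr_comp, Q.counitInv_counit, Y.tr_id]

lemma GVB.pullback_inverse_pullback (V : GVB X) :
    ((V.pullback (Q.inverse hg h₁ h₂)).pullback Q).Iso V := by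
  let R := Q.inverse hg h₁ h₂
  refine GVB.iso_of_bijective
    (fun c b => V.act (Q.unitInv c) (b := R.map _ (Q.map c b)) (b' := b)
      (Q.tr_unitInv hg h₁ h₂ c b)) (fun c b => V.act_bijective _ _) (fun c => ?_) ?_
  · intro a a' i
    obtain ⟨k, hk, h⟩ := V.act_cont (Q.unitInv c) a.down.down a' i
    let r : X.fib c → X.Arr (Q.unitInv c) := fun b =>
      ⟨(R.map _ (Q.map c b), b), Q.tr_unitInv hg h₁ h₂ c b⟩
    have hr : Continuous r := Continuous.subtype_mk
      (((R.map_cont _).comp (Q.map_cont c)).prodMk continuous_id) _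
    exact ⟨fun j b => k j (r b), fun j => (hk j).comp hr.continuousOn fun b hb => hb,
      fun b hb hb' => h (r b) hb hb'⟩
  · intro c d γ b b' h v
    have h3 : X.tr (Q.ix.inv.map (Q.ix.map γ)) (R.map _ (Q.map c b)) = R.map _ (Q.map d b') := by
      rw [← h, ← Q.map_tr γ b]
      exact R.map_tr (Q.ix.map γ) (Q.map c b)
    have h4 : X.tr (Q.unitInv c ≫ γ) (R.map _ (Q.map c b)) = b' := by
      rw [X.tr_comp]
      exact (congrArg (X.tr γ) (Q.tr_unitInv hg h₁ h₂ c b)).trans h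
    refine Eq.trans ?_ (V.act_comp _ γ (Q.tr_unitInv hg h₁ h₂ c b) h h4 v)
    refine Eq.trans ?_ (V.act_congr (Q.unitInv_naturality γ)
      (by rw [Q.unitInv_naturality]; exact h4) h4 v)
    exact (V.act_comp _ _ h3 (Q.tr_unitInv hg h₁ h₂ d b') _ v).symm

lemma GVB.pullback_pullback_inverse (V : GVB Y) :
    ((V.pullback Q).pullback (Q.inverse hg h₁ h₂)).Iso V := by
  let R := Q.inverse hg h₁ h₂
  refine GVB.iso_of_bijective
    (fun c b => V.act (Q.counit c) (b := Q.map _ (R.map c b)) (b' := b)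
      (Q.tr_counit hg h₁ h₂ c b)) (fun c b => V.act_bijective _ _) (fun c => ?_) ?_
  · intro a a' i
    obtain ⟨k, hk, h⟩ := V.act_cont (Q.counit c) a.down.down a' i
    let r : Y.fib c → Y.Arr (Q.counit c) := fun b =>
      ⟨(Q.map _ (R.map c b), b), Q.tr_counit hg h₁ h₂ c b⟩
    have hr : Continuous r := Continuous.subtype_mk
      (((Q.map_cont _).comp (R.map_cont c)).prodMk continuous_id) _
    exact ⟨fun j b => k j (r b), fun j => (hk j).comp hr.continuousOn fun b hb => hb,
      fun b hb hb' => h (r b) hb hb'⟩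
  · intro c d γ b b' h v
    have h3 : Y.tr (Q.ix.map (Q.ix.inv.map γ)) (Q.map _ (R.map c b)) = Q.map _ (R.map d b') := by
      rw [Q.map_tr, ← h, ← R.map_tr γ b]
    have h4 : Y.tr (Q.counit c ≫ γ) (Q.map _ (R.map c b)) = b' := by
      rw [Y.tr_comp]
      exact (congrArg (Y.tr γ) (Q.tr_counit hg h₁ h₂ c b)).trans h
    refine Eq.trans ?_ (V.act_comp _ γ (Q.tr_counit hg h₁ h₂ c b) h h4 v)
    refine Eq.trans ?_ (V.act_congr (Q.counit_naturality γ)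
      (by rw [Q.counit_naturality]; exact h4) h4 v)
    exact (V.act_comp _ _ h3 (Q.tr_counit hg h₁ h₂ d b') _ v).symm

include hg h₁ h₂ in
lemma GVB.iso_of_pullback_iso {V W : GVB Y} (h : (V.pullback Q).Iso (W.pullback Q)) : V.Iso W :=
  ((GVB.pullback_pullback_inverse Q hg h₁ h₂ V).symm.trans (h.pullback _)).trans
    (GVB.pullback_pullback_inverse Q hg h₁ h₂ W)

end Equivalence

/-! ### Concatenation is an equivalence -/

namespace PhiIx

lemma perm_ext {p q : PhiIx Pt} {f g : p ⟶ q} (h : ∀ l, perm f l = perm g l) : f = g :=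
  Subtype.ext (symHom_pt_ext h)

/-- An arrow of `Φ(pt)` is a bijection that commutes with the long cycles. -/
def homMk {p q : PhiIx Pt} (ρ : Fin q.len ≃ Fin p.len)
    (h : ∀ l, p.z.g.perm (ρ l) = ρ (q.z.g.perm l)) : p ⟶ q :=
  ⟨(⟨ρ, fun _ => ()⟩ : SymHom p.z.x q.z.x), symHom_pt_ext h⟩

/-- The object of `Φ_k(pt)`. -/
def std (k : ℕ) (hk : 0 < k) : PhiIx Pt where
  z := ⟨⟨k, fun _ => ⟨⟩⟩, (⟨(finRotate k).symm, fun _ => ()⟩ : SymHom _ _)⟩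
  pos := hk
  rot := rfl

lemma len_injective {p q : PhiIx Pt} (h : p.len = q.len) : p = q := by
  obtain ⟨⟨⟨n, c⟩, g⟩, pos, rot⟩ := p
  obtain ⟨⟨⟨m, d⟩, k⟩, pos', rot'⟩ := q
  obtain rfl : n = m := h
  obtain rfl : c = d := funext fun _ => rfl
  obtain rfl : g = k := symHom_pt_ext fun j => by
    rw [rot, rot']
  rfl

/-- A function on the entries that is invariant under the long cycle is constant. -/
lemma const_of_invariant (p : PhiIx Pt) {T : Type} (F : Fin p.len → T)
    (h : ∀ l, F (p.z.g.perm l) = F l) (l l' : Fin p.len) : F l = F l' :=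
  letI : TopologicalSpace T := ⊥
  phi_const (M := T) p ⟨F, funext h⟩ l l'

end PhiIx

lemma sigma_equiv_exists {I J : Type} {α : I → Type} {β : J → Type} [∀ i, Nonempty (α i)]
    [∀ j, Nonempty (β j)] (e : (Σ j, β j) ≃ Σ i, α i)
    (h : ∀ j b b', (e ⟨j, b⟩).1 = (e ⟨j, b'⟩).1)
    (h' : ∀ i a a', (e.symm ⟨i, a⟩).1 = (e.symm ⟨i, a'⟩).1) :
    ∃ (ρ : J ≃ I) (τ : ∀ j, β j ≃ α (ρ j)), e = Equiv.sigmaCongr ρ τ := by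
  have hb : ∀ a b : Σ j, β j, (e a).1 = (e b).1 → a.1 = b.1 := by
    intro a b hab
    have h3 : ∀ a b : Σ i, α i, a.1 = b.1 → (e.symm a).1 = (e.symm b).1 := by
      rintro ⟨i, a⟩ ⟨_, b⟩ rfl
      exact h' _ _ _
    simpa using h3 _ _ hab
  let r : J → I := fun j => (e ⟨j, Classical.arbitrary _⟩).1
  have hr : ∀ j b, (e ⟨j, b⟩).1 = r j := fun j b => h j _ _
  have hrb : Function.Bijective r := by
    refine ⟨fun j j' hj => hb _ _ hj, fun i => ?_⟩
    obtain ⟨⟨j, b⟩, hj⟩ := e.surjective ⟨i, Classical.arbitrary _⟩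
    exact ⟨j, by rw [← hr j b, hj]⟩
  let ρ : J ≃ I := .ofBijective r hrb
  have hex : ∀ j b, ∃ a : α (ρ j), e ⟨j, b⟩ = ⟨ρ j, a⟩ := by
    intro j b
    have := hr j b
    rcases he : e ⟨j, b⟩ with ⟨i, a⟩
    rw [he] at this
    change i = ρ j at this
    subst this
    exact ⟨a, rfl⟩
  choose t ht using hex
  have htb : ∀ j, Function.Bijective (t j) := by
    refine fun j => ⟨fun b b' hbb => ?_, fun a => ?_⟩
    · have : e ⟨j, b⟩ = e ⟨j, b'⟩ := by rw [ht, ht, hbb]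
      simpa using this
    · obtain ⟨⟨j', b⟩, hb'⟩ := e.surjective ⟨ρ j, a⟩
      obtain rfl : j' = j := hrb.1 (by rw [← hr j' b, hb']; rfl)
      exact ⟨b, by simpa [ht] using hb'⟩
  exact ⟨ρ, fun j => .ofBijective (t j) (htb j), Equiv.ext fun ⟨j, b⟩ => ht j b⟩

instance (p : PhiIx Pt) : Nonempty (Fin p.len) := ⟨⟨0, p.pos⟩⟩

instance : concat.Faithful where
  map_injective {x y} f g h := by
    obtain ⟨p, s⟩ := f
    obtain ⟨q, t⟩ := g
    have key : ∀ j l, (⟨p j, PhiIx.perm (s j) l⟩ : Σ i, Fin (x.c i).len) =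
        ⟨q j, PhiIx.perm (t j) l⟩ := by
      intro j l
      apply (slots x).injective
      have := DFunLike.congr_fun (congrArg (fun f => SymHom.perm (Subtype.val f)) h)
        (slots y ⟨j, l⟩)
      exact (concatPerm_slots ⟨p, s⟩ j l).symm.trans (this.trans (concatPerm_slots ⟨q, t⟩ j l))
    obtain rfl : p = q := Equiv.ext fun j =>
      congrArg Sigma.fst (key j (Classical.arbitrary _))
    obtain rfl : s = t := funext fun j => PhiIx.perm_ext fun l => by
      simpa using key j l
    rfl

instance : concat.Full where
  map_surjective {x y} φ := by
    let σ : Fin (∑ j, (y.c j).len) ≃ Fin (∑ i, (x.c i).len) := SymHom.perm φ.1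
    let e : (Σ j, Fin (y.c j).len) ≃ Σ i, Fin (x.c i).len :=
      ((slots y).trans σ).trans (slots x).symm
    have he : ∀ a, slots x (e a) = σ (slots y a) := fun a => by simp [e]
    have hσ : ∀ a, SymHom.perm (concatObj x).g (σ a) = σ (SymHom.perm (concatObj y).g a) := fun a =>
      DFunLike.congr_fun (congrArg SymHom.perm φ.2) a
    have hc : ∀ j l, e ⟨j, (y.c j).z.g.perm l⟩ =
        ⟨(e ⟨j, l⟩).1, (x.c _).z.g.perm (e ⟨j, l⟩).2⟩ := by
      intro j l
      apply (slots x).injective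
      rw [he, ← concatObj_perm, ← hσ, ← he, ← concatObj_perm]
    have hc' : ∀ i l, e.symm ⟨i, (x.c i).z.g.perm l⟩ =
        ⟨(e.symm ⟨i, l⟩).1, (y.c _).z.g.perm (e.symm ⟨i, l⟩).2⟩ := by
      intro i l
      have h3 : e ⟨(e.symm ⟨i, l⟩).1, (e.symm ⟨i, l⟩).2⟩ = ⟨i, l⟩ := e.apply_symm_apply _
      rw [Equiv.symm_apply_eq, hc, h3]
    obtain ⟨ρ, τ, h⟩ := sigma_equiv_exists e
      (fun j l l' => (y.c j).const_of_invariant (fun l => (e ⟨j, l⟩).1)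
        (fun l => by rw [hc]) l l')
      (fun i l l' => (x.c i).const_of_invariant (fun l => (e.symm ⟨i, l⟩).1)
        (fun l => by rw [hc']) l l')
    have h' : ∀ j l, e ⟨j, l⟩ = ⟨ρ j, τ j l⟩ := fun j l => by rw [h]; rfl
    refine ⟨(⟨ρ, fun j => PhiIx.homMk (τ j) fun l => ?_⟩ : SymHom x y),
      Subtype.ext (symHom_pt_ext fun a => ?_)⟩
    · have := hc j l
      rw [h', h'] at this
      simpa using this.symm
    · obtain ⟨⟨j, l⟩, rfl⟩ := (slots y).surjective a
      refine (concatPerm_slots _ j l).trans ?_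
      change slots x ⟨ρ j, τ j l⟩ = σ _
      rw [← he, h']

lemma exists_cycle_decomposition {n : ℕ} (h : Equiv.Perm (Fin n)) :
    ∃ (r : ℕ) (k : Fin r → ℕ) (_ : ∀ i, 0 < k i) (τ : (Σ i, Fin (k i)) ≃ Fin n),
      ∀ i l, h (τ ⟨i, l⟩) = τ ⟨i, finRotate (k i) l⟩ := by
  classical
  let S := Equiv.Perm.SameCycle.setoid h
  let ε := Fintype.equivFin (Quotient S)
  let rep : Fin (Fintype.card (Quotient S)) → Fin n := fun i => (ε.symm i).out
  have hrep : ∀ i, Quotient.mk S (rep i) = ε.symm i := fun i => Quotient.out_eq _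
  let k : Fin (Fintype.card (Quotient S)) → ℕ := fun i => Function.minimalPeriod h (rep i)
  have hk : ∀ i, 0 < k i := fun i =>
    Function.minimalPeriod_pos_of_mem_periodicPts (h.injective.mem_periodicPts _)
  have hsame : ∀ i (l : ℕ), Quotient.mk S (h^[l] (rep i)) = ε.symm i := by
    intro i l
    rw [← hrep]
    refine Quotient.sound ?_
    change Equiv.Perm.SameCycle h _ _
    rw [← Equiv.Perm.coe_pow, Equiv.Perm.sameCycle_pow_left]
  let t : (Σ i, Fin (k i)) → Fin n := fun a => h^[a.2] (rep a.1)
  have ht : Function.Bijective t := by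
    constructor
    · rintro ⟨i, l⟩ ⟨i', l'⟩ hl
      obtain rfl : i = i' := ε.symm.injective (by
        rw [← hsame i l, ← hsame i' l']; exact congrArg _ hl)
      have := (Function.iterate_eq_iterate_iff_of_lt_minimalPeriod l.2 l'.2).1 hl
      rw [Fin.ext this]
    · intro j
      have h1 : Equiv.Perm.SameCycle h (rep (ε (Quotient.mk S j))) j := by
        refine Quotient.exact (s := S) ?_
        rw [hrep, Equiv.symm_apply_apply]
      obtain ⟨m, -, hm⟩ := h1.exists_pow_eq'
      refine ⟨⟨ε (Quotient.mk S j), ⟨m % k _, Nat.mod_lt _ (hk _)⟩⟩, ?_⟩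
      change h^[m % Function.minimalPeriod h _] _ = _
      rw [Function.iterate_mod_minimalPeriod_eq, ← Equiv.Perm.coe_pow, hm]
  refine ⟨_, k, hk, .ofBijective t ht, fun i l => ?_⟩
  change h (h^[(l : ℕ)] (rep i)) = h^[((finRotate (k i) l : Fin (k i)) : ℕ)] (rep i)
  rw [← Function.iterate_succ_apply' h]
  have h2 : ∀ (m : ℕ) (l : Fin m), ((finRotate m l : Fin m) : ℕ) = (l + 1) % m := by
    intro m l
    obtain ⟨m, rfl⟩ : ∃ m', m = m' + 1 := ⟨m - 1, by have := l.pos; omega⟩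
    rw [finRotate_apply, Fin.val_add]
    simp
  rw [h2]
  exact (Function.iterate_mod_minimalPeriod_eq).symm

instance : concat.EssSurj where
  mem_essImage z := by
    obtain ⟨r, k, hk, τ, hτ⟩ := exists_cycle_decomposition (SymHom.perm z.g).symm
    let x : SymIx (PhiIx Pt) := ⟨r, fun i => PhiIx.std (k i) (hk i)⟩
    let σ : Fin z.x.n ≃ Fin (∑ i, (x.c i).len) := τ.symm.trans (slots x)
    let f : concatObj x ⟶ z := ⟨(⟨σ, fun _ => ()⟩ : SymHom _ _), symHom_pt_ext fun j => by
      obtain ⟨⟨i, l⟩, rfl⟩ := τ.surjective j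
      change SymHom.perm (concatObj x).g (slots x (τ.symm (τ ⟨i, l⟩))) =
        slots x (τ.symm (SymHom.perm z.g (τ ⟨i, l⟩)))
      rw [Equiv.symm_apply_apply]
      refine (concatObj_perm x i l).trans (congrArg (slots x) ?_)
      refine (Equiv.eq_symm_apply τ).2 ((Equiv.symm_apply_eq _).1 ?_)
      refine (hτ i ((finRotate (k i)).symm l)).trans ?_
      rw [Equiv.apply_symm_apply]⟩
    exact ⟨x, ⟨⟨f, Groupoid.inv f, Groupoid.comp_inv f, Groupoid.inv_comp f⟩⟩⟩

instance : concat.IsEquivalence where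

section Space

variable {M : Type u} [TopologicalSpace M]

/-- The inverse of `Q` on the spaces of objects. -/
def QInv (M : Type u) [TopologicalSpace M] (x : SymIx (PhiIx Pt))
    (y : (Inertia (Sym (space M))).fib (concat.obj x)) : (Sym (Phi (space M))).fib x :=
  fun i => ⟨fun l => y.1 (slots x ⟨i, l⟩), funext fun l => by
    have := congrFun y.2 (slots x ⟨i, l⟩)
    change y.1 (SymHom.perm (concatObj x).g (slots x ⟨i, l⟩)) = _ at this
    rw [concatObj_perm] at this
    exact this⟩

lemma QInv_continuous (x : SymIx (PhiIx Pt)) : Continuous (QInv M x) := by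
  refine continuous_pi fun i => Continuous.subtype_mk (continuous_pi fun l => ?_) _
  exact (continuous_apply (slots x ⟨i, l⟩)).comp continuous_subtype_val

lemma QInv_Q (x : SymIx (PhiIx Pt)) (b : (Sym (Phi (space M))).fib x) :
    QInv M x ((Q M).map x b) = b := by
  refine funext fun i => Subtype.ext (funext fun l => ?_)
  change (fun q : Σ i, Fin (x.c i).len => (b q.1).1 q.2) ((slots x).symm (slots x ⟨i, l⟩)) = _
  rw [Equiv.symm_apply_apply]

lemma Q_QInv (x : SymIx (PhiIx Pt)) (y : (Inertia (Sym (space M))).fib (concat.obj x)) :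
    (Q M).map x (QInv M x y) = y := by
  refine Subtype.ext (funext fun j => ?_)
  change y.1 (slots x ((slots x).symm j)) = _
  exact congrArg y.1 ((slots x).apply_symm_apply j)

instance : (Q M).ix.IsEquivalence := inferInstanceAs concat.IsEquivalence

/-- The canonical centre element of an inertia groupoid. -/
def centre {C : Type} [Groupoid.{0} C] (z : InIx C) : z ⟶ z := ⟨z.g, rfl⟩

/-- The arrow of `S(Φ(pt))` that rotates all the long cycles. -/
def rotation (x : SymIx (PhiIx Pt)) : x ⟶ x :=
  (⟨Equiv.refl _, fun i => PhiIx.homMk (x.c i).z.g.perm fun _ => rfl⟩ : SymHom x x)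

lemma concat_rotation (x : SymIx (PhiIx Pt)) : concat.map (rotation x) = centre (concat.obj x) := by
  refine Subtype.ext (symHom_pt_ext fun j => ?_)
  obtain ⟨⟨i, l⟩, rfl⟩ := (slots x).surjective j
  exact (concatPerm_slots (rotation x) i l).trans (concatObj_perm x i l).symm

lemma theta_power_rotation (V : VB M) (x : SymIx (PhiIx Pt)) {b : (Sym (Phi (space M))).fib x}
    (h : (Sym (Phi (space M))).tr (rotation x) b = b) (v : (V.theta.power.bdl x).E b) :
    V.theta.power.act (rotation x) h v = v := by
  refine LinearMap.congr_fun
    (f := permTensor (E := fun i => (V.theta.bdl (x.c i)).E (b i))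
      (F := fun i => (V.theta.bdl (x.c i)).E (b i)) (Equiv.refl _)
      fun j => V.theta.act (SymHom.hom (rotation x) j) (b := b j) (b' := b j) (congrFun h j))
    (g := LinearMap.id) ?_ v
  refine PiTensorProduct.ext (MultilinearMap.ext fun w => ?_)
  exact permTensor_tprod (Equiv.refl _) _ w

/-- A bundle on `Λ(S(M))` whose pull-back along `Q` is `P(θ(V))` satisfies the rotation condition. -/
lemma isRot_of_pullback_iso {V : VB M} {W : GVB (Inertia (Sym (space M)))}
    (h : (W.pullback (Q M)).Iso V.theta.power) : IsRot W := by
  obtain ⟨f, -, -, hf⟩ := h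
  have key : ∀ (x : SymIx (PhiIx Pt)) (b : (Sym (Phi (space M))).fib x)
      (v : (W.bdl (concat.obj x)).E ((Q M).map x b))
      (h : (Inertia (Sym (space M))).tr (centre (concat.obj x)) ((Q M).map x b) = (Q M).map x b),
      W.act (c := concat.obj x) (d := concat.obj x) (centre (concat.obj x)) h v = v := by
    intro x b v h
    have hb : (Sym (Phi (space M))).tr (rotation x) b = b := by
      rw [← QInv_Q x ((Sym (Phi (space M))).tr (rotation x) b), ← (Q M).map_tr (rotation x) b]
      refine (congrArg (QInv M x) ?_).trans (QInv_Q x b)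
      exact (congrArg (fun γ => (Inertia (Sym (space M))).tr γ ((Q M).map x b))
        (concat_rotation x)).trans h
    have h1 : (W.pullback (Q M)).act (rotation x) hb v = v := by
      apply (f x b).injective
      exact (hf (rotation x) hb v).trans (theta_power_rotation V x hb (f x b v))
    exact Eq.trans (W.act_congr (concat_rotation x).symm _ _ v) h1
  intro z b v
  let x := concat.objPreimage z
  let ψ : concat.obj x ⟶ z := (concat.objObjPreimageIso z).hom
  let y := (Inertia (Sym (space M))).tr (Groupoid.inv ψ) b
  have hy : (Inertia (Sym (space M))).tr ψ y = b := by
    rw [← (Inertia (Sym (space M))).tr_comp, Groupoid.inv_comp, (Inertia (Sym (space M))).tr_id]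
  have hy' : (Q M).map x (QInv M x y) = y := Q_QInv x y
  have hb : (Inertia (Sym (space M))).tr (centre z) b = b := Subtype.ext b.2
  have hc : (Inertia (Sym (space M))).tr (centre (concat.obj x)) y = y := Subtype.ext y.2
  have key' : ∀ (y' : (Inertia (Sym (space M))).fib (concat.obj x)) (_ : y' = y)
      (v : (W.bdl (concat.obj x)).E y)
      (_ : ∀ (v : (W.bdl (concat.obj x)).E y')
        (h : (Inertia (Sym (space M))).tr (centre (concat.obj x)) y' = y'),
        W.act (c := concat.obj x) (d := concat.obj x) (centre (concat.obj x)) h v = v),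
      W.act (c := concat.obj x) (d := concat.obj x) (centre (concat.obj x)) hc v = v := by
    rintro _ rfl v h
    exact h v hc
  obtain ⟨u, rfl⟩ := (W.act_bijective ψ hy).2 v
  have nat : ψ ≫ centre z = centre (concat.obj x) ≫ ψ := Subtype.ext ψ.2.symm
  have hn : (Inertia (Sym (space M))).tr (ψ ≫ centre z) y = b := by
    rw [(Inertia (Sym (space M))).tr_comp, hy, hb]
  have hn' : (Inertia (Sym (space M))).tr (centre (concat.obj x) ≫ ψ) y = b := by
    rw [(Inertia (Sym (space M))).tr_comp, hc, hy]
  change W.act (centre z) hb _ = _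
  rw [← W.act_comp ψ (centre z) hy hb hn, W.act_congr nat hn hn',
    W.act_comp (centre (concat.obj x)) ψ hc hy hn', key' _ hy' u (key x _)]

lemma exists_isPTate (V : VB M) : ∃ W, IsPTate V W :=
  ⟨_, isRot_of_pullback_iso (GVB.pullback_inverse_pullback (Q M) QInv_continuous QInv_Q Q_QInv _),
    GVB.pullback_inverse_pullback (Q M) QInv_continuous QInv_Q Q_QInv V.theta.power⟩

lemma IsPTate.iso {V : VB M} {W W' : GVB (Inertia (Sym (space M)))} (h : IsPTate V W)
    (h' : IsPTate V W') : W.Iso W' :=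
  GVB.iso_of_pullback_iso (Q M) QInv_continuous QInv_Q Q_QInv (h.2.trans h'.2.symm)

end Space

/-! ### Words in the long cycles -/

/-- The length of a long cycle, as a positive number. -/
def PhiIx.len' (p : PhiIx Pt) : ℕ+ := ⟨p.len, p.pos⟩

lemma PhiIx.len'_injective : Function.Injective PhiIx.len' := fun _ _ h =>
  PhiIx.len_injective (congrArg PNat.val h)

lemma PhiIx.len'_eq_of_hom {p q : PhiIx Pt} (f : p ⟶ q) : p.len' = q.len' :=
  PNat.eq (by
    have := (Fintype.card_congr (PhiIx.perm f)).symm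
    rwa [Fintype.card_fin, Fintype.card_fin] at this)

lemma PhiIx.len'_std (k : ℕ+) : (PhiIx.std k k.pos).len' = k := rfl

/-- The arrow between words that belongs to a permutation which respects the letters. -/
def homOfPerm {x y : SymIx (PhiIx Pt)} (ρ : Fin y.n ≃ Fin x.n) (h : ∀ j, x.c (ρ j) = y.c j) :
    x ⟶ y :=
  (⟨ρ, fun j => eqToHom (h j)⟩ : SymHom x y)

lemma letter_eq_of_hom {x y : SymIx (PhiIx Pt)} (f : x ⟶ y) (j : Fin y.n) :
    x.c (SymHom.perm f j) = y.c j :=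
  PhiIx.len'_injective (PhiIx.len'_eq_of_hom (SymHom.hom f j))

/-- The total weight of a word. -/
def wt (g : ℕ+ → ℕ) (x : SymIx (PhiIx Pt)) : ℕ := ∑ i, g (x.c i).len'

lemma wt_eq_of_hom (g : ℕ+ → ℕ) {x y : SymIx (PhiIx Pt)} (f : x ⟶ y) : wt g x = wt g y :=
  (Fintype.sum_equiv (SymHom.perm f) _ _ fun j => by rw [letter_eq_of_hom f j]).symm

/-- The word `u k k ⋯ k`. -/
def append (u : SymIx (PhiIx Pt)) (k : ℕ+) (m : ℕ) : SymIx (PhiIx Pt) where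
  n := u.n + m
  c i := Sum.elim u.c (fun _ => PhiIx.std k k.pos) (finSumFinEquiv.symm i)

/-- The numbering of the letters of the word `u k k ⋯ k`. -/
def blocks (u : SymIx (PhiIx Pt)) (k : ℕ+) (m : ℕ) : Fin u.n ⊕ Fin m ≃ Fin (append u k m).n :=
  finSumFinEquiv

lemma append_c (u : SymIx (PhiIx Pt)) (k : ℕ+) (m : ℕ) (i : Fin u.n ⊕ Fin m) :
    (append u k m).c (blocks u k m i) = Sum.elim u.c (fun _ => PhiIx.std k k.pos) i :=
  congrArg (Sum.elim u.c fun _ => PhiIx.std k k.pos) (finSumFinEquiv.symm_apply_apply i)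

lemma wt_append (g : ℕ+ → ℕ) (u : SymIx (PhiIx Pt)) (k : ℕ+) (m : ℕ) :
    wt g (append u k m) = wt g u + m * g k := by
  have h : wt g (append u k m) = ∑ i, g ((append u k m).c (blocks u k m i)).len' :=
    (Equiv.sum_comp (blocks u k m) fun i => g ((append u k m).c i).len').symm
  rw [h, Fintype.sum_sum_type]
  simp only [append_c, Sum.elim_inl, Sum.elim_inr, PhiIx.len'_std, wt, Finset.sum_const,
    Finset.card_univ, Fintype.card_fin, smul_eq_mul]

lemma exists_append_hom (x : SymIx (PhiIx Pt)) (k : ℕ+) : ∃ u m,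
    (∀ i, (u.c i).len' ≠ k) ∧ (∀ i, ∃ j, u.c i = x.c j) ∧ Nonempty (append u k m ⟶ x) := by
  classical
  let p : Fin x.n → Prop := fun i => (x.c i).len' ≠ k
  let e₁ := Fintype.equivFin {i // p i}
  let e₂ := Fintype.equivFin {i // ¬ p i}
  let e : Fin (Fintype.card {i // p i}) ⊕ Fin (Fintype.card {i // ¬ p i}) ≃ Fin x.n :=
    (Equiv.sumCongr e₁.symm e₂.symm).trans (Equiv.sumCompl p)
  let u : SymIx (PhiIx Pt) := ⟨_, fun i => x.c (e₁.symm i)⟩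
  let B : Fin (Fintype.card {i // p i}) ⊕ Fin (Fintype.card {i // ¬ p i}) ≃
    Fin (append u k (Fintype.card {i // ¬ p i})).n := blocks u k _
  refine ⟨u, Fintype.card {i // ¬ p i}, fun i => (e₁.symm i).2, fun i => ⟨_, rfl⟩,
    ⟨homOfPerm (e.symm.trans B) fun j => ?_⟩⟩
  obtain ⟨i, rfl⟩ := e.surjective j
  have h : e.symm.trans B (e i) = blocks u k _ i := congrArg B (e.symm_apply_apply i)
  rw [h, append_c]
  rcases i with i | i
  · rfl
  · exact PhiIx.len'_injective (not_not.1 (e₂.symm i).2).symm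

lemma sum_equiv_exists {α β α' β' : Type*} (e : α ⊕ β ≃ α' ⊕ β')
    (h : ∀ a, ∃ a', e (.inl a) = .inl a') (h' : ∀ b, ∃ b', e (.inr b) = .inr b') :
    ∃ (e₁ : α ≃ α') (e₂ : β ≃ β'), e = Equiv.sumCongr e₁ e₂ := by
  choose f hf using h
  choose g hg using h'
  have hfb : Function.Bijective f := by
    refine ⟨fun a b hab => Sum.inl_injective (e.injective (by rw [hf, hf, hab])), fun a => ?_⟩
    obtain ⟨b | b, hb⟩ := e.surjective (.inl a)
    · exact ⟨b, Sum.inl_injective (by rw [← hf, hb])⟩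
    · rw [hg] at hb; cases hb
  have hgb : Function.Bijective g := by
    refine ⟨fun a b hab => Sum.inr_injective (e.injective (by rw [hg, hg, hab])), fun a => ?_⟩
    obtain ⟨b | b, hb⟩ := e.surjective (.inr a)
    · rw [hf] at hb; cases hb
    · exact ⟨b, Sum.inr_injective (by rw [← hg, hb])⟩
  refine ⟨.ofBijective f hfb, .ofBijective g hgb, Equiv.ext ?_⟩
  rintro (a | b)
  · exact hf a
  · exact hg b

/-- Arrows between words of the form `u k k ⋯ k` are block sums. -/
lemma append_hom_eq {u v : SymIx (PhiIx Pt)} {k : ℕ+} {l m : ℕ} (hu : ∀ i, (u.c i).len' ≠ k)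
    (hv : ∀ i, (v.c i).len' ≠ k) (f : append u k l ⟶ append v k m) :
    ∃ (ρ : Fin v.n ≃ Fin u.n) (τ : Fin m ≃ Fin l), (∀ j, u.c (ρ j) = v.c j) ∧
      ∀ i, SymHom.perm f (blocks v k m i) = blocks u k l (Sum.map ρ τ i) := by
  let e : Fin v.n ⊕ Fin m ≃ Fin u.n ⊕ Fin l :=
    ((blocks v k m).trans (SymHom.perm f)).trans (blocks u k l).symm
  have he : ∀ i, blocks u k l (e i) = SymHom.perm f (blocks v k m i) := fun i =>
    (blocks u k l).apply_symm_apply _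
  have hc : ∀ i, Sum.elim u.c (fun _ => PhiIx.std k k.pos) (e i) =
      Sum.elim v.c (fun _ => PhiIx.std k k.pos) i := by
    intro i
    rw [← append_c, ← append_c, he]
    exact letter_eq_of_hom f _
  obtain ⟨ρ, τ, hρ⟩ := sum_equiv_exists e
    (fun a => by
      have h := hc (.inl a)
      rcases hb : e (.inl a) with b | b <;> rw [hb] at h
      · exact ⟨b, rfl⟩
      · exact (hv a (congrArg PhiIx.len' h).symm).elim)
    (fun a => by
      have h := hc (.inr a)
      rcases hb : e (.inr a) with b | b <;> rw [hb] at h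
      · exact (hu b (congrArg PhiIx.len' h)).elim
      · exact ⟨b, rfl⟩)
  refine ⟨ρ, τ, fun j => ?_, fun i => ?_⟩
  · have := hc (.inl j)
    rwa [hρ] at this
  · rw [← he, hρ]
    rfl

/-- The block sum of two permutations of letters. -/
lemma exists_append_hom_of_perm {u v : SymIx (PhiIx Pt)} (k : ℕ+) {l m : ℕ}
    (ρ : Fin v.n ≃ Fin u.n) (τ : Fin m ≃ Fin l) (h : ∀ j, u.c (ρ j) = v.c j) :
    ∃ f : append u k l ⟶ append v k m,
      ∀ i, SymHom.perm f (blocks v k m i) = blocks u k l (Sum.map ρ τ i) := by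
  refine ⟨homOfPerm (((blocks v k m).symm.trans (Equiv.sumCongr ρ τ)).trans (blocks u k l))
    fun j => ?_, fun i => ?_⟩
  · obtain ⟨i, rfl⟩ := (blocks v k m).surjective j
    rw [append_c, Equiv.trans_apply, Equiv.trans_apply, Equiv.symm_apply_apply, append_c]
    rcases i with i | i
    · exact h i
    · rfl
  · exact congrArg (fun i => blocks u k l (Equiv.sumCongr ρ τ i))
      ((blocks v k m).symm_apply_apply i)

instance (n : ℕ) : Finite {x : SymIx (PhiIx Pt) // wt (fun k => k) x = n} :=
  Finite.of_injective (β := Composition n) (fun x =>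
    { blocks := List.ofFn fun i => (x.1.c i).len
      blocks_pos := fun {i} hi => by
        obtain ⟨j, rfl⟩ := List.mem_ofFn.1 hi
        exact (x.1.c j).pos
      blocks_sum := by rw [List.sum_ofFn]; exact x.2 }) fun x y h => by
    obtain ⟨⟨n, c⟩, hx⟩ := x
    obtain ⟨⟨m, d⟩, hy⟩ := y
    obtain ⟨rfl, h⟩ := Sigma.mk.inj (List.ofFn_inj'.1 (congrArg Composition.blocks h))
    obtain rfl : c = d := funext fun i => PhiIx.len_injective (congrFun (eq_of_heq h) i)
    rfl

instance (x y : SymIx (PhiIx Pt)) : Finite (x ⟶ y) :=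
  Finite.of_injective (fun f => concat.map f) concat.map_injective

section Space

variable {M : Type u} [TopologicalSpace M]

variable (M) in
/-- The diagonal functor `S(Φ(pt)) × M → S(Φ(M))`. -/
def diagPhi : TFun (times (SymIx (PhiIx Pt)) M) (Sym (Phi (space M))) where
  ix := 𝟭 _
  map _ x := fun _ => ⟨fun _ => x, rfl⟩
  map_cont _ := continuous_pi fun _ => (continuous_pi fun _ => continuous_id).subtype_mk _
  map_tr _ _ := rfl

/-- The restriction of `P(θ(V))` to the diagonal. -/
def VB.words (V : VB M) : GVB (times (SymIx (PhiIx Pt)) M) :=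
  V.theta.power.pullback (diagPhi M)

/-- The restriction of `P(V)` to the diagonal. -/
def VB.tensorPowers (V : VB M) : GVB (times (SymIx Pt) M) :=
  V.ofSpace.power.pullback (diag M)

/-- The tensor `v₁ ⊗ ⋯ ⊗ vₙ` in the fibre at a word of `n` letters. -/
def VB.wordsTprod (V : VB M) (x : SymIx (PhiIx Pt)) {b : M} (v : Fin x.n → V.E b) :
    (V.words.bdl x).E b :=
  PiTensorProduct.tprod ℂ v

lemma VB.words_actAt (V : VB M) {x y : SymIx (PhiIx Pt)} (f : x ⟶ y) {b : M}
    (v : Fin x.n → V.E b) :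
    V.words.actAt f b (V.wordsTprod x v) = V.wordsTprod y fun j => v (SymHom.perm f j) :=
  permTensor_tprod _ _ _

/-- The tensor `v₁ ⊗ ⋯ ⊗ vₙ`. -/
def VB.powersTprod (V : VB M) (x : SymIx Pt) {b : M} (v : Fin x.n → V.E b) :
    (V.tensorPowers.bdl x).E b :=
  PiTensorProduct.tprod ℂ v

lemma VB.powers_actAt (V : VB M) {x y : SymIx Pt} (f : x ⟶ y) {b : M}
    (v : Fin x.n → V.E b) :
    V.tensorPowers.actAt f b (V.powersTprod x v) =
      V.powersTprod y fun j => v (SymHom.perm f j) :=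
  permTensor_tprod _ _ _

/-- The isomorphism `V^{⊗m} ⊗ V^{⊗n} ≅ V^{⊗(m+n)}`. -/
def VB.mulWords (V : VB M) (u : SymIx (PhiIx Pt)) (k : ℕ+) (y : SymIx Pt) (b : M) :
    ((V.words.box V.tensorPowers).bdl (u, y)).E b ≃ₗ[ℂ] (V.words.bdl (append u k y.n)).E b :=
  (PiTensorProduct.tmulEquiv ℂ (V.E b)).trans
    (PiTensorProduct.reindex ℂ (fun _ => V.E b) finSumFinEquiv)

lemma VB.mulWords_tprod (V : VB M) (u : SymIx (PhiIx Pt)) (k : ℕ+) (y : SymIx Pt) {b : M}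
    (v : Fin u.n → V.E b) (w : Fin y.n → V.E b) :
    V.mulWords u k y b (V.wordsTprod u v ⊗ₜ[ℂ] V.powersTprod y w) =
      V.wordsTprod (append u k y.n) fun i => Sum.elim v w ((blocks u k y.n).symm i) :=
  (congrArg (PiTensorProduct.reindex ℂ (fun _ => V.E b) finSumFinEquiv)
    (PiTensorProduct.tmulEquiv_apply ℂ (V.E b) v w)).trans
    (PiTensorProduct.reindex_tprod finSumFinEquiv _)

lemma VB.secAt_wordsTprod (V : VB M) (x : SymIx (PhiIx Pt)) {a : V.A} (i : Fin x.n → V.ι a)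
    {b₀ : M} (hb : b₀ ∈ V.U a) :
    (V.words.bdl x).SecAt (fun b => V.wordsTprod x fun j => V.s a (i j) b) b₀ :=
  (V.words.bdl x).secAt_frame (a := ⟨fun _ => ⟨a⟩⟩) (fun _ => hb) i

lemma VB.mulWords_mor (V : VB M) (u : SymIx (PhiIx Pt)) (k : ℕ+) (y : SymIx Pt) :
    VB.Mor ((V.words.box V.tensorPowers).bdl (u, y)) (V.words.bdl (append u k y.n))
      fun b => (V.mulWords u k y b).toLinearMap := by
  refine mor_of_frames fun b₀ => ?_
  obtain ⟨a, ha⟩ := V.cover b₀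
  refine ⟨(⟨fun _ => ⟨a⟩⟩, ⟨fun _ => ⟨a⟩⟩), ⟨fun _ => ha, fun _ => ha⟩, fun i => ?_⟩
  refine (V.secAt_wordsTprod (append u k y.n)
    (fun j => Sum.elim i.1 i.2 ((blocks u k y.n).symm j)) ha).congr (.of_forall fun b => ?_)
  refine (V.mulWords_tprod u k y (fun j => V.s a (i.1 j) b) fun j => V.s a (i.2 j) b).trans ?_
  congr 1
  funext j
  rcases (blocks u k y.n).symm j with l | l <;> rfl

lemma VB.words_actAt_mulWords (V : VB M) {u v : SymIx (PhiIx Pt)} {k : ℕ+} {y z : SymIx Pt}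
    (f : append u k y.n ⟶ append v k z.n) (g : ((u, y) : SymIx (PhiIx Pt) × SymIx Pt) ⟶ (v, z))
    (h : ∀ i, SymHom.perm f (blocks v k z.n i) =
      blocks u k y.n (Sum.map (SymHom.perm g.1) (SymHom.perm g.2) i)) (b : M)
    (t : ((V.words.box V.tensorPowers).bdl (u, y)).E b) :
    V.words.actAt f b (V.mulWords u k y b t) =
      V.mulWords v k z b ((V.words.box V.tensorPowers).actAt g b t) := by
  have key : ∀ (p : Fin u.n → V.E b) (q : Fin y.n → V.E b),
      V.words.actAt f b (V.mulWords u k y b (V.wordsTprod u p ⊗ₜ[ℂ] V.powersTprod y q)) =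
        V.mulWords v k z b (V.words.actAt g.1 b (V.wordsTprod u p) ⊗ₜ[ℂ]
          V.tensorPowers.actAt g.2 b (V.powersTprod y q)) := by
    intro p q
    rw [mulWords_tprod, words_actAt, words_actAt, powers_actAt, mulWords_tprod]
    congr 1
    funext j
    obtain ⟨i, rfl⟩ := (blocks v k z.n).surjective j
    rw [h, Equiv.symm_apply_apply, Equiv.symm_apply_apply]
    rcases i with i | i <;> rfl
  refine LinearMap.congr_fun (f := (V.words.actAt f b).comp (V.mulWords u k y b).toLinearMap)
    (g := (V.mulWords v k z b).toLinearMap.comp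
      (TensorProduct.map (V.words.actAt g.1 b) (V.tensorPowers.actAt g.2 b))) ?_ t
  exact TensorProduct.ext (PiTensorProduct.ext (MultilinearMap.ext fun p =>
    PiTensorProduct.ext (MultilinearMap.ext fun q => key p q)))

lemma VB.mulWords_symm_actAt (V : VB M) {u v : SymIx (PhiIx Pt)} {k : ℕ+} {y z : SymIx Pt}
    (f : append u k y.n ⟶ append v k z.n) (g : ((u, y) : SymIx (PhiIx Pt) × SymIx Pt) ⟶ (v, z))
    (h : ∀ i, SymHom.perm f (blocks v k z.n i) =
      blocks u k y.n (Sum.map (SymHom.perm g.1) (SymHom.perm g.2) i)) (b : M)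
    (w : (V.words.bdl (append u k y.n)).E b) :
    (V.mulWords v k z b).symm (V.words.actAt f b w) =
      (V.words.box V.tensorPowers).actAt g b ((V.mulWords u k y b).symm w) := by
  rw [LinearEquiv.symm_apply_eq, ← V.words_actAt_mulWords f g h, LinearEquiv.apply_symm_apply]

end Space

section Space

variable {M : Type u} [TopologicalSpace M] (V : VB M)

lemma cls_transfer_congr {C : Type} [Groupoid.{0} C] [∀ c d : C, Finite (c ⟶ d)]
    (W : GVB (times C M)) {P Q : C → Prop} [Finite {c // P c}] [Finite {c // Q c}]
    (h : ∀ c, P c ↔ Q c) : (transfer W P).cls = (transfer W Q).cls := by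
  obtain rfl : P = Q := funext fun c => propext (h c)
  rfl

lemma VB.symPowTate_iso (n : ℕ) :
    (V.symPowTate n).Iso (transfer V.words fun x => wt (fun k => k) x = n) := by
  obtain ⟨f, hf, -, hf'⟩ := (Classical.epsilon_spec (exists_isPTate V)).2
  refine transfer_iso (fun x => ⟨concat.obj x.1, x.2⟩)
    (fun x b => f x.1 ((diagPhi M).map x.1 b)) (fun x a a' i => ?_) (fun x y δ => ?_)
    (fun x y γ => ?_) fun z => ?_
  · obtain ⟨k, hk, h⟩ := hf x.1 ⟨a.down⟩ a'.down i
    exact ⟨fun j b => k j ((diagPhi M).map x.1 b),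
      fun j => (hk j).comp ((diagPhi M).map_cont x.1).continuousOn fun b hb => hb,
      fun b hb hb' => h _ hb hb'⟩
  · exact ⟨concat.map δ, fun b v => hf' δ (b := (diagPhi M).map x.1 b)
      (b' := (diagPhi M).map y.1 b) rfl v⟩
  · obtain ⟨δ, rfl⟩ := concat.map_surjective γ
    exact ⟨δ, fun b v => hf' δ (b := (diagPhi M).map x.1 b)
      (b' := (diagPhi M).map y.1 b) rfl v⟩
  · let ψ : concat.obj (concat.objPreimage z.1) ⟶ z.1 := (concat.objObjPreimageIso z.1).hom
    have h := Fintype.card_congr (SymHom.perm ψ.1)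
    rw [Fintype.card_fin, Fintype.card_fin] at h
    exact ⟨⟨concat.objPreimage z.1, h.symm.trans z.2⟩, ⟨ψ⟩⟩

/-- The words of weight `n` with letters in `s`. -/
def IsWord (s : Finset ℕ+) (n : ℕ) (x : SymIx (PhiIx Pt)) : Prop :=
  (∀ i, (x.c i).len' ∈ s) ∧ wt (fun k => k) x = n

instance (s : Finset ℕ+) (n : ℕ) : Finite {x // IsWord s n x} :=
  inferInstanceAs (Finite {x : SymIx (PhiIx Pt) // (∀ i, (x.c i).len' ∈ s) ∧ wt (fun k => k) x = n})

instance (s : Finset ℕ+) (n m : ℕ) :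
    Finite {d : SymIx (PhiIx Pt) × SymIx Pt // IsWord s n d.1 ∧ d.2.n = m} :=
  finite_prod_and (P := IsWord s n) (P' := fun y : SymIx Pt => y.n = m)

/-- The class of the transfer over the words of weight `n` with letters in `s`. -/
def VB.wordClass (s : Finset ℕ+) (n : ℕ) : K M :=
  (transfer V.words (IsWord s n)).cls

lemma wt_split (k : ℕ+) (x : SymIx (PhiIx Pt)) :
    wt (fun c => if c = k then (c : ℕ) else 0) x + wt (fun c => if c = k then 0 else (c : ℕ)) x =
      wt (fun c => c) x := by
  rw [wt, wt, ← Finset.sum_add_distrib]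
  refine Finset.sum_congr rfl fun i _ => ?_
  split_ifs <;> simp

lemma wt_of_ne {k : ℕ+} {x : SymIx (PhiIx Pt)} (h : ∀ i, (x.c i).len' ≠ k) :
    wt (fun c => if c = k then (c : ℕ) else 0) x = 0 :=
  Finset.sum_eq_zero fun i _ => if_neg (h i)

lemma VB.transfer_words_iso {s : Finset ℕ+} {k : ℕ+} (hk : k ∉ s) (m j n : ℕ)
    (hn : m * k + j = n) :
    (transfer V.words fun x => (wt (fun c => if c = k then (c : ℕ) else 0) x,
      wt (fun c => if c = k then 0 else (c : ℕ)) x) = (m * (k : ℕ), j) ∧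
        IsWord (insert k s) n x).Iso
    (transfer (V.words.box V.tensorPowers) fun d => IsWord s j d.1 ∧ d.2.n = m) := by
  have hne : ∀ x : SymIx (PhiIx Pt), (∀ i, (x.c i).len' ∈ s) → ∀ i, (x.c i).len' ≠ k :=
    fun x hx i hi => hk (hi ▸ hx i)
  refine transfer_iso (fun d => ⟨append d.1.1 k d.1.2.n, ?_⟩)
    (fun d b => (V.mulWords d.1.1 k d.1.2 b).symm) (fun d => (V.mulWords_mor d.1.1 k d.1.2).symm)
    (fun d e δ => ?_) (fun d e γ => ?_) fun x => ?_
  · obtain ⟨⟨u, y⟩, ⟨hu, hj⟩, rfl⟩ := d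
    have h1 := wt_split k u
    rw [wt_of_ne (hne u hu), zero_add, hj] at h1
    refine ⟨?_, fun i => ?_, ?_⟩
    · rw [wt_append, wt_append, wt_of_ne (hne u hu), h1]
      simp
    · obtain ⟨i, rfl⟩ := (blocks u k y.n).surjective i
      dsimp only
      rw [append_c]
      rcases i with i | i
      · exact Finset.mem_insert_of_mem (hu i)
      · exact Finset.mem_insert_self _ _
    · dsimp only at hj ⊢
      rw [wt_append, hj, ← hn, add_comm]
  · obtain ⟨⟨u, y⟩, hd⟩ := d
    obtain ⟨⟨v, z⟩, he⟩ := e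
    obtain ⟨γ, hγ⟩ := exists_append_hom_of_perm k (SymHom.perm δ.1) (SymHom.perm δ.2)
      (letter_eq_of_hom δ.1)
    exact ⟨γ, fun b w => V.mulWords_symm_actAt γ δ hγ b w⟩
  · obtain ⟨⟨u, y⟩, hd⟩ := d
    obtain ⟨⟨v, z⟩, he⟩ := e
    obtain ⟨ρ, τ, h, hγ⟩ := append_hom_eq (hne _ hd.1.1) (hne _ he.1.1) γ
    let δ : ((u, y) : SymIx (PhiIx Pt) × SymIx Pt) ⟶ (v, z) :=
      (homOfPerm ρ h, (⟨τ, fun _ => ()⟩ : SymHom y z))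
    exact ⟨δ, fun b w => V.mulWords_symm_actAt γ δ hγ b w⟩
  · obtain ⟨x, hx, hs, -⟩ := x
    obtain ⟨u, l, hu, hu', ⟨f⟩⟩ := exists_append_hom x k
    rw [← wt_eq_of_hom _ f, ← wt_eq_of_hom _ f, wt_append, wt_append, wt_of_ne hu,
      Prod.mk.injEq] at hx
    have h1 := wt_split k u
    rw [wt_of_ne hu, zero_add] at h1
    have hl : l = m := by
      have := hx.1
      simp only [if_true, zero_add] at this
      exact Nat.eq_of_mul_eq_mul_right k.pos this
    refine ⟨⟨(u, ⟨l, fun _ => ⟨⟩⟩), ⟨fun i => ?_, ?_⟩, hl⟩, ⟨f⟩⟩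
    · obtain ⟨j, hj⟩ := hu' i
      change (u.c i).len' ∈ s
      exact (Finset.mem_insert.1 (hj ▸ hs j)).resolve_left (hu i)
    · have := hx.2
      simp only [if_true, mul_zero, add_zero] at this
      rw [← h1, this]

lemma VB.wordClass_insert {s : Finset ℕ+} {k : ℕ+} (hk : k ∉ s) (n : ℕ) :
    V.wordClass (insert k s) n = ∑ p ∈ Finset.HasAntidiagonal.antidiagonal n,
      (if (k : ℕ) ∣ p.1 then (V.symPow (p.1 / k)).cls else 0) * V.wordClass s p.2 := by
  let f : SymIx (PhiIx Pt) → ℕ × ℕ := fun x =>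
    (wt (fun c => if c = k then (c : ℕ) else 0) x, wt (fun c => if c = k then 0 else (c : ℕ)) x)
  have h1 : V.wordClass (insert k s) n = (transfer V.words fun x =>
      f x ∈ Finset.HasAntidiagonal.antidiagonal n ∧ IsWord (insert k s) n x).cls :=
    cls_transfer_congr _ fun x => by
      refine ⟨fun h => ⟨?_, h⟩, fun h => h.2⟩
      rw [Finset.HasAntidiagonal.mem_antidiagonal]
      exact (wt_split k x).trans h.2
  rw [h1, cls_transfer_fiberwise V.words _ f fun x y γ =>
    congrArg₂ Prod.mk (wt_eq_of_hom _ γ) (wt_eq_of_hom _ γ)]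
  refine Finset.sum_congr rfl fun p hp => ?_
  rw [Finset.HasAntidiagonal.mem_antidiagonal] at hp
  obtain ⟨i, j⟩ := p
  dsimp only at hp ⊢
  split_ifs with hdvd
  · obtain ⟨m, rfl⟩ := hdvd
    rw [Nat.mul_div_cancel_left m k.pos]
    rw [mul_comm (k : ℕ) m] at hp ⊢
    have h2 := cls_eq_of_iso
      (transfer_box V.words (IsWord s j) V.tensorPowers fun y : SymIx Pt => y.n = m)
    rw [cls_tensor, mul_comm] at h2
    exact (cls_eq_of_iso (V.transfer_words_iso hk m j n hp)).trans h2.symm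
  · rw [zero_mul]
    refine cls_transfer_eq_zero _ fun x hx => hdvd ?_
    obtain ⟨u, l, hu, -, ⟨γ⟩⟩ := exists_append_hom x k
    have h2 := (Prod.mk.inj hx.1).1
    rw [← wt_eq_of_hom _ γ, wt_append, wt_of_ne hu] at h2
    exact ⟨l, by rw [← h2]; simp [mul_comm]⟩

lemma VB.wordClass_empty (n : ℕ) : V.wordClass ∅ n = if n = 0 then 1 else 0 := by
  have hx : ∀ x : SymIx (PhiIx Pt), (∀ i, (x.c i).len' ∈ (∅ : Finset ℕ+)) → x.n = 0 := fun x hx => by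
    by_contra h
    exact Finset.notMem_empty _ (hx ⟨0, Nat.pos_of_ne_zero h⟩)
  split_ifs with hn
  · subst hn
    rw [← cls_one (B := M)]
    let P : SymIx (PhiIx Pt) → Prop := IsWord ∅ 0
    have : ∀ x : {x // P x}, IsEmpty (Fin x.1.n) := fun x => by
      rw [hx x.1 x.2.1]; infer_instance
    let e : ∀ (x : {x // P x}) (b : M), V.wordsTprod x.1 (b := b) = fun _ =>
      V.wordsTprod x.1 (b := b) (fun i => (this x).elim i) := fun x b =>
        funext fun v => congrArg _ (funext fun i => (this x).elim i)
    let L : ∀ b : M, ℂ →ₗ[ℂ] limFibre V.words P b := fun b =>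
      LinearMap.toSpanSingleton ℂ _ ⟨fun x => V.wordsTprod x.1 fun i => (this x).elim i,
        fun x y γ => by
          refine (V.words_actAt γ (b := b) _).trans ?_
          rw [e y b]⟩
    refine (cls_eq_of_iso (Mor.iso_of_bijective (f := L) (mor_transfer fun x =>
      mor_of_frames fun b₀ => ?_) fun b => ?_)).symm
    · obtain ⟨a, ha⟩ := V.cover b₀
      refine ⟨⟨⟩, trivial, fun _ => (V.secAt_wordsTprod x.1 (fun i => (this x).elim i) ha).congr
        (.of_forall fun b => ?_)⟩
      refine (one_smul ℂ (V.wordsTprod x.1 (b := b) fun i => (this x).elim i)).trans ?_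
      rw [e x b]
    · let x₀ : {x // P x} := ⟨⟨0, Fin.elim0⟩, fun i => i.elim0, rfl⟩
      have hx₀ : ∀ x : {x // P x}, x = x₀ := by
        rintro ⟨⟨n, c⟩, h⟩
        obtain rfl : n = 0 := hx _ h.1
        exact Subtype.ext (congrArg (SymIx.mk 0) (funext fun i => i.elim0))
      let ε : (V.words.bdl x₀.1).E b ≃ₗ[ℂ] ℂ :=
        PiTensorProduct.isEmptyEquiv (s := fun _ => V.E b) (Fin 0)
      have hε : ε (V.wordsTprod x₀.1 fun i => (this x₀).elim i) = 1 :=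
        PiTensorProduct.isEmptyEquiv_apply_tprod (Fin 0) _
      have hL : ∀ z, ε ((L b z).1 x₀) = z := fun z => by
        change ε (z • V.wordsTprod x₀.1 fun i => (this x₀).elim i) = z
        rw [map_smul, hε, smul_eq_mul, mul_one]
      refine ⟨Function.LeftInverse.injective (g := fun w : limFibre V.words P b => ε (w.1 x₀)) hL,
        fun (w : limFibre V.words P b) => ⟨ε (w.1 x₀), Subtype.ext (funext fun x => ?_)⟩⟩
      rw [hx₀ x]
      exact ε.injective (hL _)
  · refine cls_transfer_eq_zero _ fun x hP => hn ?_
    rw [← hP.2]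
    refine Finset.sum_eq_zero fun i _ => ?_
    exact absurd (hP.1 i) (Finset.notMem_empty _)

lemma VB.prod_expand_S (s : Finset ℕ+) :
    ∏ k ∈ s, PowerSeries.expand (k : ℕ) k.ne_zero V.S =
      PowerSeries.mk fun n => (PowerSeries.C (V.wordClass s n) : KTate M) := by
  classical
  induction s using Finset.induction_on with
  | empty =>
    ext n : 1
    rw [Finset.prod_empty, PowerSeries.coeff_mk, PowerSeries.coeff_one, wordClass_empty]
    split_ifs <;> simp
  | insert k s hk ih =>
    ext n : 1
    rw [Finset.prod_insert hk, ih, PowerSeries.coeff_mul, PowerSeries.coeff_mk,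
      wordClass_insert V hk, map_sum]
    refine Finset.sum_congr rfl fun p _ => ?_
    rw [PowerSeries.coeff_mk, map_mul, PowerSeries.coeff_expand]
    congr 1
    split_ifs with h
    · rw [S, PowerSeries.coeff_mk]; rfl
    · simp

lemma VB.hasFormalProd_expand_S :
    HasFormalProd (fun k : ℕ+ => PowerSeries.expand (k : ℕ) k.ne_zero V.S) V.STate := by
  intro n
  filter_upwards [eventually_ge_atTop (Finset.Icc 1 n.succPNat)] with s hs
  rw [prod_expand_S, STate, PowerSeries.coeff_mk, PowerSeries.coeff_mk, clsTate,
    cls_eq_of_iso (V.symPowTate_iso n)]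
  refine congrArg (PowerSeries.C (R := K M)) (cls_transfer_congr _ fun x => ⟨fun h => h.2, fun h => ⟨fun i => ?_, h⟩⟩)
  refine hs (Finset.mem_Icc.2 ⟨one_le, ?_⟩)
  have h1 : ((x.c i).len' : ℕ) ≤ n := by
    rw [← h]
    exact Finset.single_le_sum (f := fun i => ((x.c i).len' : ℕ)) (fun _ _ => Nat.zero_le _)
      (Finset.mem_univ i)
  exact PNat.coe_le_coe _ _ |>.1 (h1.trans (Nat.le_succ n))

end Space

end TateK

end

theorem mainTheorem4 {M : Type*} [TopologicalSpace M] (V : TateK.VB M) :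
    (∃ W, TateK.IsPTate V W) ∧
    (∀ W W', TateK.IsPTate V W → TateK.IsPTate V W' → W.Iso W') ∧
    TateK.HasFormalProd (fun k : ℕ+ => PowerSeries.expand (k : ℕ) k.ne_zero V.S) V.STate :=
  ⟨TateK.exists_isPTate V, fun _ _ => TateK.IsPTate.iso, V.hasFormalProd_expand_S⟩
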